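/- Let $C$ be a set and let $P$ be a symmetric $C$-coloured operad in sets (with identity operations $\mathrm{id}_c$; operations of arity $0$ are allowed). The twisted arrow category $\mathrm{Tw}(P)$ is defined as follows. Let $TO(P)$ be the $C$-coloured operad generated by two copies of the operations of $P$, the elements $p'$ of the first copy (called variables) being free and the elements of the second copy (called constants) being subject to all relations that hold in $P$; that is, $TO(P)$ is the coproduct $F(U(P))\sqcup P$ of $P$ with the free $C$-coloured operad on the operations of $P$. (Symmetric groups act freely on the operations of a free operad, which is generated by the family of sets $P(c_1,\dots,c_n;c_0)$.) Each element of $TO(P)$ has a well-defined multiset of variables, and there is an evaluation map $TO(P)\to P$ which sends both copies of an operation $p$ to $p$. The objects of $\mathrm{Tw}(P)$ are the operations of $P$. A morphism $p\to r$ is an element of $TO(P)$ that contains exactly one variable, namely $p'$, and whose evaluation is $r$. The identity of $p$ is $p'$, and the composite of $f:p\to q$ and $g:q\to r$ is obtained by substituting $f$ for the variable $q'$ in $g$. For $p\in P(c_1,\dots,c_n;c_0)$ and $1\le j\le n$ the $j$-th input map $in_j:\mathrm{id}_{c_j}\to p$ is the element $p\circ_j \mathrm{id}_{c_j}'$ of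 $TO(P)$, with $p$ a constant and $\mathrm{id}_{c_j}'$ a variable. A presheaf of sets $X:\mathrm{Tw}(P)^{op}\to \mathrm{Set}$ is called a single-object Segal $P$-presheaf if for all $n\ge 0$, all colours $c_0,\dots,c_n$ and every $p\in P(c_1,\dots,c_n;c_0)$ the map $$(X(in_j))_{1\le j\le n}:\ X(p)\longrightarrow \prod_{j=1}^n X(\mathrm{id}_{c_j})$$ is bijective (in particular $X(p)$ is a one-point set if $p$ has arity $0$). Theorem. For every symmetric coloured set-operad $P$, the category of single-object Segal $P$-presheaves (the full subcategory of the category of presheaves of sets on $\mathrm{Tw}(P)$) is equivalent to the category of $P$-algebras in sets and their homomorphisms. -/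

import Mathlib

open CategoryTheory Opposite

universe u v w

/-! ### Coloured symmetric operads in sets -/

namespace SetOperad

/-- The `l`-th position of a concatenation of blocks of lengths `k 0, k 1, …`, as a pair
(block, position in the block); blocks are concatenated in lexicographic order. -/
abbrev split {n : ℕ} {k : Fin n → ℕ} (l : Fin (∑ i, k i)) : (i : Fin n) × Fin (k i) :=
  finSigmaFinEquiv.symm l

/-- Concatenation of the lists of colours `b 0, b 1, …`. -/
abbrev concat {C : Type u} {n : ℕ} {k : Fin n → ℕ} (b : ∀ i, Fin (k i) → C) :
    Fin (∑ i, k i) → C :=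
  fun l => b (split l).1 (split l).2

/-- A single block of length `k` has length `k`. -/
def oneBlock (k : ℕ) : Fin (∑ _i : Fin 1, k) ≃ Fin k :=
  finSigmaFinEquiv.symm.trans
    ((Equiv.sigmaEquivProd (Fin 1) (Fin k)).trans (Equiv.uniqueProd (Fin k) (Fin 1)))

/-- `n` blocks of length `1` have total length `n`. -/
def unitBlocks (n : ℕ) : Fin (∑ _i : Fin n, 1) ≃ Fin n :=
  finSigmaFinEquiv.symm.trans (Equiv.sigmaUnique (Fin n) fun _ => Fin 1)

/-- Position `j` of block `i` of the permuted sequence of blocks goes to position `j` of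
block `e i`. -/
def permBlocks {m n : ℕ} (e : Fin m ≃ Fin n) (k : Fin n → ℕ) :
    Fin (∑ i, k (e i)) ≃ Fin (∑ j, k j) :=
  finSigmaFinEquiv.symm.trans
    ((Equiv.sigmaCongrLeft (β := fun j => Fin (k j)) e).trans finSigmaFinEquiv)

/-- Permutation of the positions inside each block. -/
def innerBlocks {n : ℕ} {k k' : Fin n → ℕ} (e : ∀ i, Fin (k' i) ≃ Fin (k i)) :
    Fin (∑ i, k' i) ≃ Fin (∑ i, k i) :=
  finSigmaFinEquiv.symm.trans ((Equiv.sigmaCongrRight e).trans finSigmaFinEquiv)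

/-- Concatenating a sequence of sequences of blocks in the two possible ways. -/
def assocBlocks {n : ℕ} {k : Fin n → ℕ} (m : ∀ i, Fin (k i) → ℕ) :
    Fin (∑ l : Fin (∑ i, k i), m (split l).1 (split l).2) ≃ Fin (∑ i, ∑ j, m i j) :=
  finSigmaFinEquiv.symm.trans <|
    (Equiv.sigmaCongrLeft (β := fun s : (i : Fin n) × Fin (k i) => Fin (m s.1 s.2))
      finSigmaFinEquiv.symm).trans <|
    (Equiv.sigmaAssoc fun i j => Fin (m i j)).trans <|
    (Equiv.sigmaCongrRight fun _ => finSigmaFinEquiv).trans finSigmaFinEquiv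

section colours

variable {C : Type u} {n : ℕ} {k : Fin n → ℕ} (b : ∀ i, Fin (k i) → C)

theorem concat_finSigmaFinEquiv (s : (i : Fin n) × Fin (k i)) :
    concat b (finSigmaFinEquiv s) = b s.1 s.2 :=
  congrArg (fun t : (i : Fin n) × Fin (k i) => b t.1 t.2) (finSigmaFinEquiv.symm_apply_apply s)

theorem concat_permBlocks {m : ℕ} (e : Fin m ≃ Fin n) (l : Fin (∑ i, k (e i))) :
    concat (fun i => b (e i)) l = concat b (permBlocks e k l) :=
  (concat_finSigmaFinEquiv b ⟨e (split l).1, (split l).2⟩).symm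

theorem concat_innerBlocks {k' : Fin n → ℕ} {b' : ∀ i, Fin (k' i) → C}
    (e : ∀ i, Fin (k' i) ≃ Fin (k i)) (h : ∀ i j, b' i j = b i (e i j)) (l : Fin (∑ i, k' i)) :
    concat b' l = concat b (innerBlocks e l) :=
  (h _ _).trans
    (concat_finSigmaFinEquiv b ⟨(split l).1, e (split l).1 (split l).2⟩).symm

theorem concat_assocBlocks {m : ∀ i, Fin (k i) → ℕ} (a : ∀ i j, Fin (m i j) → C)
    (l : Fin (∑ l : Fin (∑ i, k i), m (split l).1 (split l).2)) :
    concat (fun l => a (split l).1 (split l).2) l =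
      concat (fun i => concat (a i)) (assocBlocks m l) := by
  let i := (split (split l).1).1
  let j := (split (split l).1).2
  let x : Fin (m i j) := (split l).2
  exact ((concat_finSigmaFinEquiv (fun i => concat (a i)) ⟨i, finSigmaFinEquiv ⟨j, x⟩⟩).trans
    (concat_finSigmaFinEquiv (a i) ⟨j, x⟩)).symm

theorem concat_oneBlock (c : Fin n → C) (l : Fin (∑ _i : Fin 1, n)) :
    concat (k := fun _ : Fin 1 => n) (fun _ => c) l = c (oneBlock n l) :=
  rfl

theorem concat_unitBlocks (c : Fin n → C) (l : Fin (∑ _i : Fin n, 1)) :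
    concat (k := fun _ => 1) (fun i _ => c i) l = c (unitBlocks n l) :=
  rfl

theorem concat_unitBlocks_symm (c : Fin n → C) (i : Fin n) :
    c i = concat (k := fun _ => 1) (fun i _ => c i) ((unitBlocks n).symm i) :=
  congrArg c ((unitBlocks n).apply_symm_apply i).symm

end colours

end SetOperad

open SetOperad in
/-- A symmetric set-operad with set of colours `C`. `Op c d` is the set of operations with input
colours `c 0, …, c (n - 1)` and output colour `d`.

The symmetric groups act on the right: `perm e _ p` is the operation `p^e`, whose `i`-th input is
the `e i`-th input of `p`. Bijections `e : Fin m ≃ Fin n` exist only for `m = n`, so that this is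
the usual action; allowing `m` and `n` to be different expressions of the same number, and the
colours of the result to be propositionally equal to `c ∘ e`, avoids casts in the axioms. -/
structure SetOperad (C : Type u) : Type (max u (v + 1)) where
  /-- operations -/
  Op : {n : ℕ} → (Fin n → C) → C → Type v
  /-- identity operations -/
  one (c : C) : Op (fun _ : Fin 1 => c) c
  /-- action of permutations -/
  perm {m n : ℕ} {a : Fin m → C} {c : Fin n → C} {d : C} (e : Fin m ≃ Fin n)
    (h : ∀ i, a i = c (e i)) (p : Op c d) : Op a d
  /-- composition `p(q 0, …, q (n - 1))` -/
  comp {n : ℕ} {c : Fin n → C} {d : C} {k : Fin n → ℕ} {b : ∀ i, Fin (k i) → C}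
    (p : Op c d) (q : ∀ i, Op (b i) (c i)) : Op (concat b) d
  perm_refl {n : ℕ} {c : Fin n → C} {d : C} (p : Op c d) :
    perm (Equiv.refl _) (fun _ => rfl) p = p
  perm_perm {l m n : ℕ} {a : Fin l → C} {b : Fin m → C} {c : Fin n → C} {d : C}
    (e : Fin l ≃ Fin m) (f : Fin m ≃ Fin n) (h : ∀ i, a i = b (e i)) (h' : ∀ i, b i = c (f i))
    (p : Op c d) :
    perm e h (perm f h' p) = perm (e.trans f) (fun i => (h i).trans (h' (e i))) p
  one_comp {n : ℕ} {c : Fin n → C} {d : C} (q : Op c d) :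
    comp (one d) (fun _ => q) = perm (oneBlock n) (concat_oneBlock c) q
  comp_one {n : ℕ} {c : Fin n → C} {d : C} (p : Op c d) :
    comp p (fun i => one (c i)) = perm (unitBlocks n) (concat_unitBlocks c) p
  assoc {n : ℕ} {c : Fin n → C} {d : C} {k : Fin n → ℕ} {b : ∀ i, Fin (k i) → C}
    {m : ∀ i, Fin (k i) → ℕ} {a : ∀ i j, Fin (m i j) → C}
    (p : Op c d) (q : ∀ i, Op (b i) (c i)) (r : ∀ i j, Op (a i j) (b i j)) :
    comp (comp p q) (fun l => r (split l).1 (split l).2) =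
      perm (assocBlocks m) (concat_assocBlocks a) (comp p fun i => comp (q i) (r i))
  perm_comp {m n : ℕ} {c : Fin n → C} {d : C} {k : Fin n → ℕ} {b : ∀ i, Fin (k i) → C}
    (e : Fin m ≃ Fin n) (p : Op c d) (q : ∀ i, Op (b i) (c i)) :
    comp (perm (a := fun i => c (e i)) e (fun _ => rfl) p) (fun i => q (e i)) =
      perm (permBlocks e k) (concat_permBlocks b e) (comp p q)
  comp_perm {n : ℕ} {c : Fin n → C} {d : C} {k k' : Fin n → ℕ} {b : ∀ i, Fin (k i) → C}
    {b' : ∀ i, Fin (k' i) → C} (p : Op c d) (q : ∀ i, Op (b i) (c i))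
    (e : ∀ i, Fin (k' i) ≃ Fin (k i)) (h : ∀ i j, b' i j = b i (e i j)) :
    comp p (fun i => perm (e i) (h i) (q i)) =
      perm (innerBlocks e) (concat_innerBlocks b e h) (comp p q)

namespace SetOperad

variable {C : Type u}

/-! ### Algebras -/

/-- An algebra over a set-operad, with values in `Type w`. -/
structure Algebra (P : SetOperad.{u, v} C) : Type (max u v (w + 1)) where
  /-- the set of elements of each colour -/
  carrier : C → Type w
  /-- `act p x` is the element `p(x 0, …, x (n - 1))` -/
  act {n : ℕ} {c : Fin n → C} {d : C} (p : P.Op c d) (x : ∀ i, carrier (c i)) : carrier d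
  act_one (c : C) (x : Fin 1 → carrier c) : act (P.one c) x = x 0
  act_perm {m n : ℕ} {c : Fin n → C} {d : C} (e : Fin m ≃ Fin n) (p : P.Op c d)
    (x : ∀ i, carrier (c i)) :
    act (P.perm (a := fun i => c (e i)) e (fun _ => rfl) p) (fun i => x (e i)) = act p x
  act_comp {n : ℕ} {c : Fin n → C} {d : C} {k : Fin n → ℕ} {b : ∀ i, Fin (k i) → C}
    (p : P.Op c d) (q : ∀ i, P.Op (b i) (c i)) (x : ∀ i j, carrier (b i j)) :
    act (P.comp p q) (fun l => x (split l).1 (split l).2) = act p fun i => act (q i) (x i)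

/-- A morphism of algebras: a family of maps commuting with all operations. -/
@[ext]
structure Algebra.Hom {P : SetOperad.{u, v} C} (A B : Algebra.{u, v, w} P) : Type (max u w) where
  /-- the underlying maps -/
  map (c : C) : A.carrier c → B.carrier c
  map_act {n : ℕ} {c : Fin n → C} {d : C} (p : P.Op c d) (x : ∀ i, A.carrier (c i)) :
    map d (A.act p x) = B.act p fun i => map (c i) (x i)

instance (P : SetOperad.{u, v} C) : Category (Algebra.{u, v, w} P) where
  Hom A B := Algebra.Hom A B
  id A := ⟨fun _ x => x, fun _ _ => rfl⟩
  comp f g := ⟨fun c x => g.map c (f.map c x), fun p x => by rw [f.map_act, g.map_act]⟩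

/-! ### The twisted arrow category -/

/-- The objects of the twisted arrow category: operations of `P` (of all arities and colours). -/
structure Tw (P : SetOperad.{u, v} C) : Type (max u v) where
  /-- the arity -/
  arity : ℕ
  /-- the input colours -/
  input : Fin arity → C
  /-- the output colour -/
  output : C
  /-- the operation -/
  op : P.Op input output

/-- The identity operation of colour `c` as an object of the twisted arrow category. -/
abbrev Tw.one (P : SetOperad.{u, v} C) (c : C) : Tw P := ⟨1, fun _ => c, c, P.one c⟩

/-- Formal operadic expressions in two copies of the operations of `P`: the variables `var p` and
the constants `const p`. -/
inductive Term (P : SetOperad.{u, v} C) : {n : ℕ} → (Fin n → C) → C → Type (max u v)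
  | var (p : Tw P) : Term P p.input p.output
  | const {n : ℕ} {c : Fin n → C} {d : C} (p : P.Op c d) : Term P c d
  | perm {m n : ℕ} {a : Fin m → C} {c : Fin n → C} {d : C} (e : Fin m ≃ Fin n)
      (h : ∀ i, a i = c (e i)) (t : Term P c d) : Term P a d
  | comp {n : ℕ} {c : Fin n → C} {d : C} {k : Fin n → ℕ} {b : ∀ i, Fin (k i) → C}
      (t : Term P c d) (s : ∀ i, Term P (b i) (c i)) : Term P (concat b) d

variable {P : SetOperad.{u, v} C}

/-- The congruence on formal expressions generated by the axioms of operads and by the relations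
that hold in `P` between constants. There are no relations between variables. -/
inductive Term.Rel : {n : ℕ} → {c : Fin n → C} → {d : C} → Term P c d → Term P c d → Prop
  | refl {n : ℕ} {c : Fin n → C} {d : C} (t : Term P c d) : Rel t t
  | symm {n : ℕ} {c : Fin n → C} {d : C} {t t' : Term P c d} : Rel t t' → Rel t' t
  | trans {n : ℕ} {c : Fin n → C} {d : C} {t t' t'' : Term P c d} :
      Rel t t' → Rel t' t'' → Rel t t''
  | congr_perm {m n : ℕ} {a : Fin m → C} {c : Fin n → C} {d : C} (e : Fin m ≃ Fin n)
      (h : ∀ i, a i = c (e i)) {t t' : Term P c d} : Rel t t' → Rel (perm e h t) (perm e h t')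
  | congr_comp {n : ℕ} {c : Fin n → C} {d : C} {k : Fin n → ℕ} {b : ∀ i, Fin (k i) → C}
      {t t' : Term P c d} {s s' : ∀ i, Term P (b i) (c i)} :
      Rel t t' → (∀ i, Rel (s i) (s' i)) → Rel (comp t s) (comp t' s')
  | perm_refl {n : ℕ} {c : Fin n → C} {d : C} (t : Term P c d) :
      Rel (perm (Equiv.refl _) (fun _ => rfl) t) t
  | perm_perm {l m n : ℕ} {a : Fin l → C} {b : Fin m → C} {c : Fin n → C} {d : C}
      (e : Fin l ≃ Fin m) (f : Fin m ≃ Fin n) (h : ∀ i, a i = b (e i))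
      (h' : ∀ i, b i = c (f i)) (t : Term P c d) :
      Rel (perm e h (perm f h' t)) (perm (e.trans f) (fun i => (h i).trans (h' (e i))) t)
  | one_comp {n : ℕ} {c : Fin n → C} {d : C} (t : Term P c d) :
      Rel (comp (const (P.one d)) fun _ => t) (perm (oneBlock n) (concat_oneBlock c) t)
  | comp_one {n : ℕ} {c : Fin n → C} {d : C} (t : Term P c d) :
      Rel (comp t fun i => const (P.one (c i))) (perm (unitBlocks n) (concat_unitBlocks c) t)
  | assoc {n : ℕ} {c : Fin n → C} {d : C} {k : Fin n → ℕ} {b : ∀ i, Fin (k i) → C}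
      {m : ∀ i, Fin (k i) → ℕ} {a : ∀ i j, Fin (m i j) → C}
      (t : Term P c d) (s : ∀ i, Term P (b i) (c i)) (r : ∀ i j, Term P (a i j) (b i j)) :
      Rel (comp (comp t s) fun l => r (split l).1 (split l).2)
        (perm (assocBlocks m) (concat_assocBlocks a) (comp t fun i => comp (s i) (r i)))
  | perm_comp {m n : ℕ} {c : Fin n → C} {d : C} {k : Fin n → ℕ} {b : ∀ i, Fin (k i) → C}
      (e : Fin m ≃ Fin n) (t : Term P c d) (s : ∀ i, Term P (b i) (c i)) :
      Rel (comp (perm (a := fun i => c (e i)) e (fun _ => rfl) t) fun i => s (e i))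
        (perm (permBlocks e k) (concat_permBlocks b e) (comp t s))
  | comp_perm {n : ℕ} {c : Fin n → C} {d : C} {k k' : Fin n → ℕ} {b : ∀ i, Fin (k i) → C}
      {b' : ∀ i, Fin (k' i) → C} (t : Term P c d) (s : ∀ i, Term P (b i) (c i))
      (e : ∀ i, Fin (k' i) ≃ Fin (k i)) (h : ∀ i j, b' i j = b i (e i j)) :
      Rel (comp t fun i => perm (e i) (h i) (s i))
        (perm (innerBlocks e) (concat_innerBlocks b e h) (comp t s))
  | const_perm {m n : ℕ} {a : Fin m → C} {c : Fin n → C} {d : C} (e : Fin m ≃ Fin n)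
      (h : ∀ i, a i = c (e i)) (p : P.Op c d) : Rel (perm e h (const p)) (const (P.perm e h p))
  | const_comp {n : ℕ} {c : Fin n → C} {d : C} {k : Fin n → ℕ} {b : ∀ i, Fin (k i) → C}
      (p : P.Op c d) (q : ∀ i, P.Op (b i) (c i)) :
      Rel (comp (const p) fun i => const (q i)) (const (P.comp p q))

/-- Formal expressions up to the generated congruence. -/
def Term.setoid {n : ℕ} (c : Fin n → C) (d : C) : Setoid (Term P c d) :=
  ⟨Term.Rel, ⟨Term.Rel.refl, Term.Rel.symm, Term.Rel.trans⟩⟩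

/-- The multiset of variables of a formal expression. -/
def Term.vars {n : ℕ} {c : Fin n → C} {d : C} : Term P c d → Multiset (Tw P)
  | var p => {p}
  | const _ => 0
  | perm _ _ t => t.vars
  | comp t s => t.vars + ∑ i, (s i).vars

/-- The evaluation of a formal expression in `P`. -/
def Term.eval {n : ℕ} {c : Fin n → C} {d : C} : Term P c d → P.Op c d
  | var p => p.op
  | const p => p
  | perm e h t => P.perm e h t.eval
  | comp t s => P.comp t.eval fun i => (s i).eval

/-- Simultaneous substitution of formal expressions for the variables. -/
def Term.bind (f : ∀ p : Tw P, Term P p.input p.output) {n : ℕ} {c : Fin n → C} {d : C} :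
    Term P c d → Term P c d
  | var p => f p
  | const p => const p
  | perm e h t => perm e h (t.bind f)
  | comp t s => comp (t.bind f) fun i => (s i).bind f

theorem Term.Rel.vars_eq {n : ℕ} {c : Fin n → C} {d : C} {t t' : Term P c d} (h : Rel t t') :
    t.vars = t'.vars := by
  induction h with
  | refl => rfl
  | symm _ ih => exact ih.symm
  | trans _ _ ih ih' => exact ih.trans ih'
  | congr_perm e h _ ih => exact ih
  | congr_comp _ _ ih ih' => simp only [Term.vars, ih, ih']
  | perm_refl => rfl
  | perm_perm => rfl
  | one_comp => simp [Term.vars]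
  | comp_one => simp [Term.vars]
  | assoc t s r =>
    simp only [Term.vars, Finset.sum_add_distrib, add_assoc]
    congr 2
    rw [← Fintype.sum_sigma' (fun i j => (r i j).vars)]
    exact Fintype.sum_equiv finSigmaFinEquiv.symm _ _ fun _ => rfl
  | perm_comp e t s =>
    simp only [Term.vars]
    congr 1
    exact Fintype.sum_equiv e _ _ fun _ => rfl
  | comp_perm => rfl
  | const_perm => rfl
  | const_comp => simp [Term.vars]

theorem Term.Rel.eval_eq {n : ℕ} {c : Fin n → C} {d : C} {t t' : Term P c d} (h : Rel t t') :
    t.eval = t'.eval := by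
  induction h with
  | refl => rfl
  | symm _ ih => exact ih.symm
  | trans _ _ ih ih' => exact ih.trans ih'
  | congr_perm e h _ ih => simp only [Term.eval, ih]
  | congr_comp _ _ ih ih' => simp only [Term.eval, ih, ih']
  | perm_refl => exact P.perm_refl _
  | perm_perm => exact P.perm_perm _ _ _ _ _
  | one_comp => exact P.one_comp _
  | comp_one => exact P.comp_one _
  | assoc t s r => exact P.assoc t.eval (fun i => (s i).eval) fun i j => (r i j).eval
  | perm_comp e t s => exact P.perm_comp e t.eval fun i => (s i).eval
  | comp_perm t s e h => exact P.comp_perm t.eval (fun i => (s i).eval) e h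
  | const_perm => rfl
  | const_comp => rfl

theorem Term.Rel.bind (f : ∀ p : Tw P, Term P p.input p.output) {n : ℕ} {c : Fin n → C} {d : C}
    {t t' : Term P c d} (h : Rel t t') : Rel (t.bind f) (t'.bind f) := by
  induction h with
  | refl => exact .refl _
  | symm _ ih => exact ih.symm
  | trans _ _ ih ih' => exact ih.trans ih'
  | congr_perm e h _ ih => exact .congr_perm e h ih
  | congr_comp _ _ ih ih' => exact .congr_comp ih ih'
  | perm_refl => exact .perm_refl _
  | perm_perm => exact .perm_perm _ _ _ _ _
  | one_comp => exact .one_comp _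
  | comp_one => exact .comp_one _
  | assoc t s r => exact .assoc (t.bind f) (fun i => (s i).bind f) fun i j => (r i j).bind f
  | perm_comp e t s => exact .perm_comp e (t.bind f) fun i => (s i).bind f
  | comp_perm t s e h => exact .comp_perm (t.bind f) (fun i => (s i).bind f) e h
  | const_perm => exact .const_perm _ _ _
  | const_comp => exact .const_comp _ _

theorem Term.bind_rel {f g : ∀ p : Tw P, Term P p.input p.output} (h : ∀ p, Rel (f p) (g p))
    {n : ℕ} {c : Fin n → C} {d : C} (t : Term P c d) : Rel (t.bind f) (t.bind g) := by
  induction t with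
  | var p => exact h p
  | const p => exact .refl _
  | perm e h t ih => exact .congr_perm e h ih
  | comp t s ih ih' => exact .congr_comp ih ih'

theorem Term.bind_congr {f g : ∀ p : Tw P, Term P p.input p.output} {n : ℕ} {c : Fin n → C}
    {d : C} (t : Term P c d) (h : ∀ p ∈ t.vars, f p = g p) : t.bind f = t.bind g := by
  induction t with
  | var p => exact h p (by simp [vars])
  | const p => rfl
  | perm e _ t ih => simp only [bind, ih h]
  | comp t s ih ih' =>
    simp only [bind, vars, Multiset.mem_add, Multiset.mem_sum, Finset.mem_univ, true_and] at h ⊢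
    rw [ih fun p hp => h p (.inl hp)]
    congr 1
    exact funext fun i => ih' i fun p hp => h p (.inr ⟨i, hp⟩)

theorem Term.bind_var {n : ℕ} {c : Fin n → C} {d : C} (t : Term P c d) : t.bind var = t := by
  induction t with
  | var p => rfl
  | const p => rfl
  | perm e _ t ih => simp only [bind, ih]
  | comp t s ih ih' => simp only [bind, ih, ih']

theorem Term.bind_bind (f g : ∀ p : Tw P, Term P p.input p.output) {n : ℕ} {c : Fin n → C}
    {d : C} (t : Term P c d) : (t.bind f).bind g = t.bind fun p => (f p).bind g := by
  induction t with
  | var p => rfl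
  | const p => rfl
  | perm e _ t ih => simp only [bind, ih]
  | comp t s ih ih' => simp only [bind, ih, ih']

theorem Term.vars_bind (f : ∀ p : Tw P, Term P p.input p.output) {n : ℕ} {c : Fin n → C}
    {d : C} (t : Term P c d) : (t.bind f).vars = t.vars.bind fun p => (f p).vars := by
  induction t with
  | var p => simp [bind, vars]
  | const p => rfl
  | perm e _ t ih => exact ih
  | comp t s ih ih' =>
    simp only [bind, vars, ih, ih', Multiset.add_bind]
    congr 1
    exact (map_sum (⟨⟨fun m : Multiset (Tw P) => m.bind fun p => (f p).vars, rfl⟩,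
      fun a b => Multiset.add_bind a b _⟩ : Multiset (Tw P) →+ Multiset (Tw P)) _ _).symm

theorem Term.eval_bind {f : ∀ p : Tw P, Term P p.input p.output} (h : ∀ p, (f p).eval = p.op)
    {n : ℕ} {c : Fin n → C} {d : C} (t : Term P c d) : (t.bind f).eval = t.eval := by
  induction t with
  | var p => exact h p
  | const p => rfl
  | perm e _ t ih => simp only [bind, eval, ih]
  | comp t s ih ih' => simp only [bind, eval, ih, ih']

/-- The operad `TO(P)` generated by two copies of the operations of `P`, the second copy
being subject to the relations in `P`: the coproduct of the free operad on the
operations of `P` (as variables) and of `P` itself. -/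
def TO (P : SetOperad.{u, v} C) {n : ℕ} (c : Fin n → C) (d : C) : Type (max u v) :=
  Quotient (Term.setoid (P := P) c d)

namespace TO

/-- The class of a formal expression. -/
def mk {n : ℕ} {c : Fin n → C} {d : C} (t : Term P c d) : TO P c d :=
  Quotient.mk (Term.setoid c d) t

/-- The multiset of variables of an element. -/
def vars {n : ℕ} {c : Fin n → C} {d : C} : TO P c d → Multiset (Tw P) :=
  Quotient.lift Term.vars fun _ _ h => Term.Rel.vars_eq h

/-- The evaluation of an element in `P`. -/
def eval {n : ℕ} {c : Fin n → C} {d : C} : TO P c d → P.Op c d :=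
  Quotient.lift Term.eval fun _ _ h => Term.Rel.eval_eq h

open scoped Classical in
/-- The substitution of `x` for the variable `q` in `y`. -/
noncomputable def subst (q : Tw P) (x : TO P q.input q.output) {n : ℕ} {c : Fin n → C} {d : C}
    (y : TO P c d) : TO P c d :=
  Quotient.liftOn₂ x y (fun t s => mk (s.bind (Function.update Term.var q t)))
    fun t s t' s' ht hs => Quotient.sound <| by
      refine (Term.Rel.bind _ hs).trans (Term.bind_rel (fun p => ?_) s')
      by_cases hp : p = q
      · subst hp; simpa using (show Term.Rel t t' from ht)
      · simpa [Function.update_of_ne hp] using Term.Rel.refl _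

end TO

/-- A morphism `p ⟶ r` in the twisted arrow category: an element of `TO(P)` which has exactly one
variable, namely `p`, and whose evaluation is `r`. -/
@[ext]
structure Tw.Hom (p r : Tw P) : Type (max u v) where
  /-- the element of `TO(P)` -/
  elt : TO P r.input r.output
  vars_eq : elt.vars = {p}
  eval_eq : elt.eval = r.op

open scoped Classical in
/-- The twisted arrow category of `P`. The identity of `p` is the variable `p`, and
composition is substitution for the variable. -/
noncomputable instance (P : SetOperad.{u, v} C) : Category (Tw P) where
  Hom p r := Tw.Hom p r
  id p := ⟨TO.mk (.var p), rfl, rfl⟩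
  comp {p q r} f g := ⟨TO.subst q f.elt g.elt, by
    obtain ⟨⟨t⟩, ht, ht'⟩ := f
    obtain ⟨⟨s⟩, hs, hs'⟩ := g
    change (s.bind _).vars = _
    change s.vars = _ at hs
    rw [Term.vars_bind, hs]
    change t.vars = _ at ht
    simpa using ht, by
    obtain ⟨⟨t⟩, ht, ht'⟩ := f
    obtain ⟨⟨s⟩, hs, hs'⟩ := g
    refine (Term.eval_bind (fun x => ?_) s).trans hs'
    by_cases hx : x = q
    · subst hx
      rw [Function.update_self]; exact ht'
    · rw [Function.update_of_ne hx]; rfl⟩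
  id_comp {p q} g := by
    obtain ⟨⟨s⟩, hs, hs'⟩ := g
    refine Tw.Hom.ext (congrArg TO.mk ?_)
    rw [Function.update_eq_self, Term.bind_var]
  comp_id {p q} f := by
    obtain ⟨⟨t⟩, ht, ht'⟩ := f
    refine Tw.Hom.ext (congrArg TO.mk ?_)
    simp [Term.bind]
  assoc {p q r s} f g h := by
    obtain ⟨⟨t⟩, ht, ht'⟩ := f
    obtain ⟨⟨t₂⟩, ht₂, ht₂'⟩ := g
    obtain ⟨⟨t₃⟩, ht₃, ht₃'⟩ := h
    refine Tw.Hom.ext (congrArg TO.mk ?_)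
    rw [Term.bind_bind]
    refine Term.bind_congr _ fun x hx => ?_
    change t₃.vars = _ at ht₃
    rw [ht₃, Multiset.mem_singleton] at hx
    subst hx
    simp

/-- The formal expression `p ∘_j id_{c_j}`, with `p` a constant and `id_{c_j}` a variable: the
variable is the `j`-th argument of `p`, and the remaining arguments are constant identities. -/
def Tw.inputTerm (p : Tw P) (j : Fin p.arity) : Term P p.input p.output :=
  .perm (unitBlocks p.arity).symm
    (concat_unitBlocks_symm p.input)
    (.comp (.const p.op)
      (Function.update (fun i => .const (P.one (p.input i))) j (.var (Tw.one P (p.input j)))))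

theorem Tw.inputTerm_vars (p : Tw P) (j : Fin p.arity) :
    (p.inputTerm j).vars = {Tw.one P (p.input j)} := by
  simp only [inputTerm, Term.vars, zero_add]
  rw [Finset.sum_eq_single j]
  · rw [Function.update_self]; rfl
  · intro i _ hi; rw [Function.update_of_ne hi]; rfl
  · simp

theorem Tw.inputTerm_eval (p : Tw P) (j : Fin p.arity) : (p.inputTerm j).eval = p.op := by
  have h : (fun i => Term.eval (Function.update (fun i => Term.const (P.one (p.input i))) j
      (Term.var (Tw.one P (p.input j))) i)) = fun i => P.one (p.input i) := by
    funext i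
    by_cases hi : i = j
    · subst hi; rw [Function.update_self]; rfl
    · rw [Function.update_of_ne hi]; rfl
  simp only [inputTerm, Term.eval]
  rw [h, P.comp_one, P.perm_perm]
  simp [P.perm_refl]

/-- The `j`-th input map `id_{c_j} ⟶ p`. -/
def Tw.inputMap (p : Tw P) (j : Fin p.arity) : Tw.one P (p.input j) ⟶ p :=
  Tw.Hom.mk (TO.mk (p.inputTerm j)) (p.inputTerm_vars j) (p.inputTerm_eval j)

/-! ### Segal presheaves -/

/-- The single-object Segal condition on a presheaf `X` on the twisted arrow category: for every
operation `p` with input colours `c_0, …, c_{n-1}`, the map `X(p) → ∏ j, X(id_{c_j})` induced by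
the input maps is bijective. -/
def IsSingleObjectSegal (P : SetOperad.{u, v} C) : ObjectProperty ((Tw P)ᵒᵖ ⥤ Type w) :=
  fun X => ∀ p : Tw P, Function.Bijective
    fun (x : X.obj (op p)) (j : Fin p.arity) => X.map (Tw.inputMap p j).op x

end SetOperad

/-!
# Single-object Segal presheaves on the twisted arrow category are algebras

An algebra `A` defines the presheaf `p ↦ ∏ j, A (c_j)`, where the `c_j` are the input colours of
`p`. To restrict a family `x` along a morphism `f : p ⟶ r`, insert `x` into the inputs of the
formal expression `f`, evaluate it in `A` from the inputs on, and record the arguments to which its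
only variable `p` is applied. For an expression with any number of variables this gives a multiset
of arguments (`Term.args`), which is invariant under the relations of `TO(P)`
(`Term.Rel.args_eq`) and compatible with substitution (`Term.args_bind`); no normal form of
morphisms is needed. Restriction along the `j`-th input map is the `j`-th projection
(`restrict_inputMap`), whence the Segal condition, and restriction along the output map
`id_d ⟶ p` is the action of `p` (`restrict_outputMap`). By the former, a morphism between
presheaves of algebras is determined by its components at identities; by the latter, these
components form a homomorphism. So the functor from algebras to presheaves is fully faithful.

Conversely, for a Segal presheaf `X` the sets `X (id_c)` form an algebra: `p` acts by inverting the
Segal bijection of `p` and restricting along the output map. The axioms follow from identities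
between morphisms in the twisted arrow category, which are instances of identities for
compositions with unary operations in the operad `TO(P)` (`SetOperad.pre_comp`,
`SetOperad.post_comp`, `SetOperad.comp_pre`). The Segal bijections identify `X` with the presheaf
of this algebra. Their naturality (`segalEquiv_naturality`) has to be verified only for
renumberings of inputs and for the inclusions of the outer and of the inner operations into a
composite, because these generate all morphisms (`Tw.hom_induction`).
-/

namespace SetOperad

/-! ### Families indexed by concatenated blocks -/

section blocks

variable {n : ℕ} {k : Fin n → ℕ}

/-- Cut a family indexed by the positions of a concatenation into the families indexed by the
positions of the single blocks. -/
def block {β : ∀ i, Fin (k i) → Type w} (x : ∀ l : Fin (∑ i, k i), β (split l).1 (split l).2)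
    (i : Fin n) (j : Fin (k i)) : β i j :=
  cast (congrArg (fun s : (i : Fin n) × Fin (k i) => β s.1 s.2)
    (finSigmaFinEquiv.symm_apply_apply ⟨i, j⟩)) (x (finSigmaFinEquiv ⟨i, j⟩))

theorem block_eq_of_heq {β : ∀ i, Fin (k i) → Type w}
    {x : ∀ l : Fin (∑ i, k i), β (split l).1 (split l).2} {y : ∀ i j, β i j}
    (h : ∀ i j, x (finSigmaFinEquiv ⟨i, j⟩) ≍ y i j) : block x = y :=
  funext fun i => funext fun j => eq_of_heq ((cast_heq _ _).trans (h i j))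

/-- The concatenation `fun l => y (split l).1 (split l).2` of the families `y i` has the value
`y i j` at position `j` of block `i`. The equality is heterogeneous because the type of a value
depends on its position. -/
theorem cat_heq {β : ∀ i, Fin (k i) → Type w} (y : ∀ i j, β i j) (s : (i : Fin n) × Fin (k i)) :
    y (split (finSigmaFinEquiv s)).1 (split (finSigmaFinEquiv s)).2 ≍ y s.1 s.2 :=
  congr_arg_heq (fun t : (i : Fin n) × Fin (k i) => y t.1 t.2)
    (finSigmaFinEquiv.symm_apply_apply s)

theorem block_cat {β : ∀ i, Fin (k i) → Type w} (y : ∀ i j, β i j) :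
    block (β := β) (fun l => y (split l).1 (split l).2) = y :=
  block_eq_of_heq fun i j => cat_heq y ⟨i, j⟩

/-- Every family indexed by the positions of a concatenation is a concatenation of families. -/
theorem exists_cat {β : ∀ i, Fin (k i) → Type w}
    (x : ∀ l : Fin (∑ i, k i), β (split l).1 (split l).2) :
    ∃ y : ∀ i j, β i j, x = fun l => y (split l).1 (split l).2 := by
  refine ⟨block x, funext fun l => eq_of_heq (.trans ?_ (cast_heq _ _).symm)⟩
  exact congr_arg_heq x (finSigmaFinEquiv.apply_symm_apply l).symm

theorem unitBlocks_apply (i : Fin n) (j : Fin 1) :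
    unitBlocks n (finSigmaFinEquiv (n := fun _ => 1) ⟨i, j⟩) = i :=
  congrArg Sigma.fst (finSigmaFinEquiv.symm_apply_apply (⟨i, j⟩ : (_ : Fin n) × Fin 1))

theorem unitBlocks_symm_apply (i : Fin n) :
    (unitBlocks n).symm i = finSigmaFinEquiv (n := fun _ => 1) ⟨i, 0⟩ :=
  (Equiv.symm_apply_eq _).2 (unitBlocks_apply i 0).symm

theorem oneBlock_apply (i : Fin 1) (j : Fin n) :
    oneBlock n (finSigmaFinEquiv (n := fun _ => n) ⟨i, j⟩) = j :=
  congrArg (fun s : (_ : Fin 1) × Fin n => s.2)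
    (finSigmaFinEquiv.symm_apply_apply (⟨i, j⟩ : (_ : Fin 1) × Fin n))

theorem oneBlock_symm_apply (j : Fin n) :
    (oneBlock n).symm j = finSigmaFinEquiv (n := fun _ => n) ⟨0, j⟩ :=
  (Equiv.symm_apply_eq _).2 (oneBlock_apply 0 j).symm

theorem permBlocks_apply {m : ℕ} (e : Fin m ≃ Fin n) (i : Fin m) (j : Fin (k (e i))) :
    permBlocks e k (finSigmaFinEquiv (n := fun i => k (e i)) ⟨i, j⟩) =
      finSigmaFinEquiv ⟨e i, j⟩ :=
  congrArg (fun s : (i : Fin m) × Fin (k (e i)) => finSigmaFinEquiv (n := k) ⟨e s.1, s.2⟩)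
    (finSigmaFinEquiv.symm_apply_apply (⟨i, j⟩ : (i : Fin m) × Fin (k (e i))))

theorem innerBlocks_apply {k' : Fin n → ℕ} (e : ∀ i, Fin (k' i) ≃ Fin (k i)) (i : Fin n)
    (j : Fin (k' i)) : innerBlocks e (finSigmaFinEquiv ⟨i, j⟩) = finSigmaFinEquiv ⟨i, e i j⟩ :=
  congrArg (fun s : (i : Fin n) × Fin (k' i) => finSigmaFinEquiv (n := k) ⟨s.1, e s.1 s.2⟩)
    (finSigmaFinEquiv.symm_apply_apply ⟨i, j⟩)

theorem assocBlocks_apply (m : ∀ i, Fin (k i) → ℕ)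
    (l : Fin (∑ l : Fin (∑ i, k i), m (split l).1 (split l).2)) :
    assocBlocks m l = finSigmaFinEquiv
      ⟨(split (split l).1).1, finSigmaFinEquiv ⟨(split (split l).1).2, (split l).2⟩⟩ :=
  rfl

theorem oneBlock_assocBlocks (l : Fin (∑ l : Fin (∑ _i : Fin 1, n), k (split l).2)) :
    oneBlock _ (assocBlocks (fun _ : Fin 1 => k) l) = permBlocks (oneBlock n) k l :=
  oneBlock_apply (split (split l).1).1
    (finSigmaFinEquiv ⟨(split (split l).1).2, (split l).2⟩)

theorem assocBlocks_trans_oneBlock :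
    (assocBlocks fun _ : Fin 1 => k).trans (oneBlock _) =
    (permBlocks (oneBlock n) k : Fin (∑ l : Fin (∑ _i : Fin 1, n), k (split l).2) ≃ _) := by
  ext1 l
  rw [Equiv.trans_apply]
  exact oneBlock_assocBlocks l

end blocks

/-! ### Precomposition and postcomposition with unary operations -/

section unary

variable {C : Type u} (P : SetOperad.{u, v} C)

theorem perm_congr {m n : ℕ} {a : Fin m → C} {c : Fin n → C} {d : C} {e e' : Fin m ≃ Fin n}
    (he : e = e') (h : ∀ i, a i = c (e i)) (p : P.Op c d) :
    P.perm e h p = P.perm e' (fun i => he ▸ h i) p := by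
  subst he; rfl

theorem perm_eq_self {n : ℕ} {c : Fin n → C} {d : C} {e : Fin n ≃ Fin n}
    (he : e = Equiv.refl _) (h : ∀ i, c i = c (e i)) (p : P.Op c d) : P.perm e h p = p := by
  subst he; exact P.perm_refl p

theorem eq_perm_symm {m n : ℕ} {a : Fin m → C} {c : Fin n → C} {d : C} {e : Fin m ≃ Fin n}
    {h : ∀ i, a i = c (e i)} {p : P.Op c d} {q : P.Op a d} (H : P.perm e h p = q) :
    p = P.perm e.symm (fun i => by rw [h, e.apply_symm_apply]) q := by
  subst H
  rw [P.perm_perm, P.perm_eq_self (by simp)]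

theorem oneBlock_symm_colour {n : ℕ} (c : Fin n → C) (i : Fin n) :
    c i = concat (k := fun _ : Fin 1 => n) (fun _ => c) ((oneBlock n).symm i) :=
  (congrArg c ((oneBlock n).apply_symm_apply i)).symm.trans (concat_oneBlock c _).symm

/-- The operation `p(u 0, …, u (n - 1))` for unary operations `u i`, with inputs numbered like
those of `p`. -/
def pre {n : ℕ} {c : Fin n → C} {d : C} (p : P.Op c d)
    (u : ∀ i, P.Op (fun _ : Fin 1 => c i) (c i)) : P.Op c d :=
  P.perm (unitBlocks n).symm (concat_unitBlocks_symm c) (P.comp p u)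

/-- The operation `u(p)` for a unary operation `u`, with inputs numbered like those of `p`. -/
def post {n : ℕ} {c : Fin n → C} {d : C} (u : P.Op (fun _ : Fin 1 => d) d) (p : P.Op c d) :
    P.Op c d :=
  P.perm (oneBlock n).symm (oneBlock_symm_colour c) (P.comp u fun _ => p)

theorem comp_unary {n : ℕ} {c : Fin n → C} {d : C} (p : P.Op c d)
    (u : ∀ i, P.Op (fun _ : Fin 1 => c i) (c i)) :
    P.comp p u = P.perm (unitBlocks n) (concat_unitBlocks c) (P.pre p u) := by
  rw [pre, P.perm_perm, P.perm_eq_self (by simp)]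

theorem unary_comp {n : ℕ} {c : Fin n → C} {d : C} (u : P.Op (fun _ : Fin 1 => d) d)
    (p : P.Op c d) :
    P.comp u (fun _ => p) = P.perm (oneBlock n) (concat_oneBlock c) (P.post u p) := by
  rw [post, P.perm_perm, P.perm_eq_self (by simp)]

theorem pre_one {n : ℕ} {c : Fin n → C} {d : C} (p : P.Op c d) :
    P.pre p (fun i => P.one (c i)) = p := by
  rw [pre, P.comp_one, P.perm_perm, P.perm_eq_self (by simp)]

theorem one_post {n : ℕ} {c : Fin n → C} {d : C} (p : P.Op c d) :
    P.post (P.one d) p = p := by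
  rw [post, P.one_comp, P.perm_perm, P.perm_eq_self (by simp)]

theorem one_pre {c : C} (u : P.Op (fun _ : Fin 1 => c) c) :
    P.pre (P.one c) (fun _ => u) = u := by
  rw [pre, P.one_comp, P.perm_perm, P.perm_eq_self (Subsingleton.elim _ _)]

theorem post_one {c : C} (u : P.Op (fun _ : Fin 1 => c) c) :
    P.post u (P.one c) = u := by
  rw [post, P.comp_one u, P.perm_perm, P.perm_eq_self (Subsingleton.elim _ _)]

theorem perm_injective {m n : ℕ} {a : Fin m → C} {c : Fin n → C} {d : C} (e : Fin m ≃ Fin n)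
    (h : ∀ i, a i = c (e i)) : Function.Injective (P.perm (d := d) e h) := fun _ _ H =>
  (P.eq_perm_symm rfl).trans (P.eq_perm_symm H.symm).symm

theorem pre_perm {m n : ℕ} {c : Fin n → C} {d : C} (e : Fin m ≃ Fin n) (p : P.Op c d)
    (u : ∀ i, P.Op (fun _ : Fin 1 => c i) (c i)) :
    P.pre (P.perm (a := fun i => c (e i)) e (fun _ => rfl) p) (fun i => u (e i)) =
      P.perm e (fun _ => rfl) (P.pre p u) := by
  rw [pre, P.perm_comp e p u, P.perm_perm, pre, P.perm_perm]
  refine P.perm_congr (Equiv.ext fun i => ?_) _ _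
  rw [Equiv.trans_apply, Equiv.trans_apply, unitBlocks_symm_apply, unitBlocks_symm_apply]
  exact permBlocks_apply (k := fun _ => 1) e i 0

theorem post_perm {m n : ℕ} {a : Fin m → C} {c : Fin n → C} {d : C} (e : Fin m ≃ Fin n)
    (h : ∀ i, a i = c (e i)) (u : P.Op (fun _ : Fin 1 => d) d) (p : P.Op c d) :
    P.post u (P.perm e h p) = P.perm e h (P.post u p) := by
  rw [post, P.comp_perm u (fun _ => p) (fun _ => e) fun _ => h, P.perm_perm, post, P.perm_perm]
  refine P.perm_congr (Equiv.ext fun i => ?_) _ _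
  rw [Equiv.trans_apply, Equiv.trans_apply, oneBlock_symm_apply, oneBlock_symm_apply]
  exact innerBlocks_apply (k := fun _ => n) (k' := fun _ => m) (fun _ => e) 0 i

/-- Postcomposing a composite with a unary operation is postcomposing its outer operation. -/
theorem post_comp {n : ℕ} {c : Fin n → C} {d : C} {k : Fin n → ℕ} {b : ∀ i, Fin (k i) → C}
    (u : P.Op (fun _ : Fin 1 => d) d) (p : P.Op c d) (q : ∀ i, P.Op (b i) (c i)) :
    P.post u (P.comp p q) = P.comp (P.post u p) q := by
  have h := P.assoc u (fun _ => p) (fun _ j => q j)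
  rw [unary_comp, unary_comp, P.perm_perm] at h
  have h' := P.perm_comp (oneBlock n) (P.post u p) q
  have h'' := h.symm.trans h'
  refine P.perm_injective (permBlocks (oneBlock n) k) (concat_permBlocks b (oneBlock n)) ?_
  refine Eq.trans ?_ h''
  refine P.perm_congr ?_ _ _
  exact assocBlocks_trans_oneBlock.symm

/-- Precomposing a composite with unary operations is precomposing its inner operations. -/
theorem pre_comp {n : ℕ} {c : Fin n → C} {d : C} {k : Fin n → ℕ} {b : ∀ i, Fin (k i) → C}
    (p : P.Op c d) (q : ∀ i, P.Op (b i) (c i))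
    (u : ∀ i j, P.Op (fun _ : Fin 1 => b i j) (b i j)) :
    P.pre (P.comp p q) (fun l => u (split l).1 (split l).2) =
      P.comp p fun i => P.pre (q i) (u i) := by
  have h := P.assoc p q u
  have h' : (fun i => P.comp (q i) (u i)) = _ := funext fun i => P.comp_unary (q i) (u i)
  rw [h', P.comp_perm, P.perm_perm] at h
  rw [pre, h, P.perm_perm]
  refine P.perm_eq_self (Equiv.ext fun l => ?_) _ _
  rw [Equiv.trans_apply, Equiv.refl_apply]
  obtain ⟨l', rfl⟩ := (unitBlocks _).surjective l
  rw [Equiv.symm_apply_apply, Equiv.trans_apply, assocBlocks_apply, innerBlocks_apply]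
  exact (congrArg (fun j => finSigmaFinEquiv ⟨(split (split l').1).1, j⟩)
    (unitBlocks_apply _ _)).trans (finSigmaFinEquiv.apply_symm_apply (split l').1)

/-- A unary operation between the outer and an inner operation of a composite may be attributed to
either of them. -/
theorem comp_pre {n : ℕ} {c : Fin n → C} {d : C} {k : Fin n → ℕ} {b : ∀ i, Fin (k i) → C}
    (p : P.Op c d) (u : ∀ i, P.Op (fun _ : Fin 1 => c i) (c i)) (q : ∀ i, P.Op (b i) (c i)) :
    P.comp (P.pre p u) q = P.comp p fun i => P.post (u i) (q i) := by
  have h := P.assoc p u (fun i _ => q i)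
  have h' : (fun i => P.comp (u i) (fun _ => q i)) = _ :=
    funext fun i => P.unary_comp (u i) (q i)
  rw [h', P.comp_perm, P.perm_perm, comp_unary] at h
  refine P.perm_injective _ _ ((P.perm_comp (unitBlocks n) (P.pre p u) q).symm.trans (h.trans ?_))
  refine P.perm_congr (Equiv.ext fun l => ?_) _ _
  exact (innerBlocks_apply (fun i => oneBlock (k i)) (split (split l).1).1
    (finSigmaFinEquiv ⟨(split (split l).1).2, (split l).2⟩)).trans
    (congrArg (fun j => finSigmaFinEquiv ⟨_, j⟩) (oneBlock_apply _ _))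

end unary

variable {C : Type u} {P : SetOperad.{u, v} C}

/-! ### The operad structure on `TO(P)` -/

namespace TO

theorem mk_surjective {n : ℕ} {c : Fin n → C} {d : C} (x : TO P c d) : ∃ t, x = mk t :=
  (Quotient.exists_rep x).imp fun _ h => h.symm

theorem mk_surjective_family {n : ℕ} {c : Fin n → C} {k : Fin n → ℕ} {b : ∀ i, Fin (k i) → C}
    (x : ∀ i, TO P (b i) (c i)) : ∃ s : ∀ i, Term P (b i) (c i), x = fun i => mk (s i) :=
  ⟨fun i => (x i).out, funext fun i => (Quotient.out_eq (x i)).symm⟩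

theorem mk_eq {n : ℕ} {c : Fin n → C} {d : C} {t t' : Term P c d} (h : Term.Rel t t') :
    mk t = mk t' :=
  Quotient.sound h

/-- Renumbering of inputs in `TO(P)`. -/
def perm {m n : ℕ} {a : Fin m → C} {c : Fin n → C} {d : C} (e : Fin m ≃ Fin n)
    (h : ∀ i, a i = c (e i)) : TO P c d → TO P a d :=
  Quotient.lift (fun t => mk (.perm e h t)) fun _ _ ht => mk_eq (.congr_perm e h ht)

/-- Operadic composition in `TO(P)`, computed on representatives. -/
noncomputable def comp {n : ℕ} {c : Fin n → C} {d : C} {k : Fin n → ℕ} {b : ∀ i, Fin (k i) → C}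
    (x : TO P c d) (y : ∀ i, TO P (b i) (c i)) : TO P (concat b) d :=
  mk (.comp x.out fun i => (y i).out)

theorem comp_mk {n : ℕ} {c : Fin n → C} {d : C} {k : Fin n → ℕ} {b : ∀ i, Fin (k i) → C}
    (t : Term P c d) (s : ∀ i, Term P (b i) (c i)) :
    comp (mk t) (fun i => mk (s i)) = mk (.comp t s) :=
  mk_eq (.congr_comp (Quotient.exact (Quotient.out_eq (mk t)))
    fun i => Quotient.exact (Quotient.out_eq (mk (s i))))

variable (P) in
/-- The operad `TO(P)`. -/
noncomputable def operad : SetOperad.{u, max u v} C where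
  Op := TO P
  one c := mk (.const (P.one c))
  perm := perm
  comp := comp
  perm_refl x := by
    obtain ⟨t, rfl⟩ := mk_surjective x
    exact mk_eq (.perm_refl t)
  perm_perm e f h h' x := by
    obtain ⟨t, rfl⟩ := mk_surjective x
    exact mk_eq (.perm_perm e f h h' t)
  one_comp x := by
    obtain ⟨t, rfl⟩ := mk_surjective x
    exact (comp_mk _ _).trans (mk_eq (.one_comp t))
  comp_one x := by
    obtain ⟨t, rfl⟩ := mk_surjective x
    exact (comp_mk _ _).trans (mk_eq (.comp_one t))
  assoc {n c d k b m a} x y z := by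
    obtain ⟨t, rfl⟩ := mk_surjective x
    obtain ⟨s, rfl⟩ := mk_surjective_family y
    obtain ⟨r, rfl⟩ : ∃ r : ∀ i j, Term P (a i j) (b i j), z = fun i j => mk (r i j) :=
      ⟨fun i j => (z i j).out, funext fun i => funext fun j => (Quotient.out_eq (z i j)).symm⟩
    simp only [comp_mk]
    exact mk_eq (.assoc t s r)
  perm_comp e x y := by
    obtain ⟨t, rfl⟩ := mk_surjective x
    obtain ⟨s, rfl⟩ := mk_surjective_family y
    rw [comp_mk]
    exact (comp_mk _ _).trans (mk_eq (.perm_comp e t s))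
  comp_perm x y e h := by
    obtain ⟨t, rfl⟩ := mk_surjective x
    obtain ⟨s, rfl⟩ := mk_surjective_family y
    rw [comp_mk]
    exact (comp_mk _ _).trans (mk_eq (.comp_perm t s e h))

/-- A variable of `TO(P)`. -/
def var (p : Tw P) : (operad P).Op p.input p.output :=
  mk (.var p)

/-- A constant of `TO(P)`. -/
def const {n : ℕ} {c : Fin n → C} {d : C} (p : P.Op c d) : (operad P).Op c d :=
  mk (.const p)

theorem const_perm {m n : ℕ} {a : Fin m → C} {c : Fin n → C} {d : C} (e : Fin m ≃ Fin n)
    (h : ∀ i, a i = c (e i)) (p : P.Op c d) :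
    const (P.perm e h p) = (operad P).perm e h (const p) :=
  (mk_eq (.const_perm e h p)).symm

theorem const_comp {n : ℕ} {c : Fin n → C} {d : C} {k : Fin n → ℕ} {b : ∀ i, Fin (k i) → C}
    (p : P.Op c d) (q : ∀ i, P.Op (b i) (c i)) :
    const (P.comp p q) = (operad P).comp (const p) fun i => const (q i) :=
  ((comp_mk _ _).trans (mk_eq (.const_comp p q))).symm

theorem comp_update {n : ℕ} {c : Fin n → C} {d : C} {k : Fin n → ℕ} {b : ∀ i, Fin (k i) → C}
    (t : Term P c d) (s : ∀ i, Term P (b i) (c i)) (i : Fin n) (r : Term P (b i) (c i)) :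
    mk (.comp t (Function.update s i r)) =
      (operad P).comp (mk t) (Function.update (fun i => mk (s i)) i (mk r)) := by
  refine (comp_mk _ _).symm.trans ?_
  congr 1
  exact funext fun j => Function.apply_update (fun _ => mk) s i r j

/-- An element without variables is a constant. -/
theorem mk_eq_const {n : ℕ} {c : Fin n → C} {d : C} (t : Term P c d) (h : t.vars = 0) :
    mk t = const t.eval := by
  induction t with
  | var p => exact absurd h (Multiset.singleton_ne_zero p)
  | const p => rfl
  | perm e h' t ih =>
    exact (congrArg (perm e h') (ih h)).trans (const_perm e h' t.eval).symm
  | comp t s ih ih' =>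
    rw [Term.vars, add_eq_zero, Finset.sum_eq_zero_iff] at h
    rw [← comp_mk, ih h.1]
    refine Eq.trans ?_ (const_comp t.eval fun i => (s i).eval).symm
    exact congrArg (comp _) (funext fun i => ih' i (h.2 i (Finset.mem_univ i)))

end TO

/-! ### Generating morphisms of the twisted arrow category -/

namespace Tw

/-- The morphism from an operation to the operation with renumbered inputs. -/
def permMap {m n : ℕ} {a : Fin m → C} {c : Fin n → C} {d : C} (e : Fin m ≃ Fin n)
    (h : ∀ i, a i = c (e i)) (p : P.Op c d) :
    (⟨n, c, d, p⟩ : Tw P) ⟶ ⟨m, a, d, P.perm e h p⟩ :=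
  Tw.Hom.mk (TO.mk (.perm e h (.var ⟨n, c, d, p⟩))) rfl rfl

section

variable {n : ℕ} {c : Fin n → C} {d : C} {k : Fin n → ℕ} {b : ∀ i, Fin (k i) → C}
  (p : P.Op c d) (q : ∀ i, P.Op (b i) (c i))

/-- The morphism from the outer operation `p` of a composite to the composite. -/
def outerMap : (⟨n, c, d, p⟩ : Tw P) ⟶ ⟨_, concat b, d, P.comp p q⟩ :=
  Tw.Hom.mk (TO.mk (.comp (.var ⟨n, c, d, p⟩) fun i => .const (q i)))
    (by change {_} + ∑ i : Fin n, (0 : Multiset (Tw P)) = _; simp) rfl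

/-- The morphism from the inner operation `q i` of a composite to the composite. -/
def innerMap (i : Fin n) : (⟨k i, b i, c i, q i⟩ : Tw P) ⟶ ⟨_, concat b, d, P.comp p q⟩ :=
  Tw.Hom.mk (TO.mk (.comp (.const p)
      (Function.update (fun i => .const (q i)) i (.var ⟨k i, b i, c i, q i⟩))))
    (by
      change 0 + ∑ j, _ = _
      rw [zero_add, Finset.sum_eq_single i]
      · rw [Function.update_self]; rfl
      · intro j _ hj; rw [Function.update_of_ne hj]; rfl
      · simp)
    (by
      change P.comp p _ = _
      congr 1
      funext j
      by_cases hj : j = i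
      · subst hj; rw [Function.update_self]; rfl
      · rw [Function.update_of_ne hj]; rfl)

end

/-- The output map `id_d ⟶ p`: the element `id_d ∘ p` with `id_d` a variable and `p` a constant. -/
def outputMap (p : Tw P) : Tw.one P p.output ⟶ p :=
  Tw.Hom.mk (TO.mk (.perm (oneBlock p.arity).symm (oneBlock_symm_colour p.input)
      (.comp (.var (Tw.one P p.output)) fun _ => .const p.op)))
    (by change {_} + ∑ i : Fin 1, (0 : Multiset (Tw P)) = _; simp)
    (P.one_post p.op)

theorem hom_ext {p r : Tw P} {f g : p ⟶ r} (h : Tw.Hom.elt f = Tw.Hom.elt g) : f = g :=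
  Tw.Hom.ext h

open scoped Classical in
/-- Each morphism `f` has a representing term that computes its composites. -/
theorem exists_rep {p q : Tw P} (f : p ⟶ q) : ∃ t : Term P q.input q.output,
    Tw.Hom.elt f = TO.mk t ∧ t.eval = q.op ∧ ∀ (r : Tw P) (g : q ⟶ r) (s : Term P r.input r.output),
      Tw.Hom.elt g = TO.mk s →
        Tw.Hom.elt (f ≫ g) = TO.mk (s.bind (Function.update Term.var q t)) := by
  obtain ⟨⟨t⟩, ht, ht'⟩ := f
  refine ⟨t, rfl, ht', fun r g s hs => ?_⟩
  change TO.subst q (TO.mk t) (Tw.Hom.elt g) = _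
  rw [hs]
  rfl

/-- Composing with `permMap`, `outerMap` and `innerMap` is renumbering of inputs, grafting constants
on the inputs, and grafting onto an input of a constant, respectively. -/
theorem comp_permMap {x : Tw P} {m n : ℕ} {a : Fin m → C} {c : Fin n → C} {d : C}
    (e : Fin m ≃ Fin n) (h : ∀ i, a i = c (e i)) (p : P.Op c d) (f : x ⟶ ⟨n, c, d, p⟩) :
    Tw.Hom.elt (f ≫ permMap e h p) = (TO.operad P).perm e h (Tw.Hom.elt f) := by
  obtain ⟨t, ht, -, H⟩ := exists_rep f
  rw [ht, H _ _ _ rfl]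
  simp only [Term.bind, Function.update_self]
  rfl

section

variable {n : ℕ} {c : Fin n → C} {d : C} {k : Fin n → ℕ} {b : ∀ i, Fin (k i) → C}
  (p : P.Op c d) (q : ∀ i, P.Op (b i) (c i))

theorem comp_outerMap {x : Tw P} (f : x ⟶ ⟨n, c, d, p⟩) :
    Tw.Hom.elt (f ≫ outerMap p q) =
      (TO.operad P).comp (Tw.Hom.elt f) fun i => TO.const (q i) := by
  obtain ⟨t, ht, -, H⟩ := exists_rep f
  rw [ht, H _ _ _ rfl]
  simp only [Term.bind, Function.update_self]
  exact (TO.comp_mk _ _).symm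

theorem comp_innerMap {x : Tw P} (i : Fin n) (f : x ⟶ ⟨k i, b i, c i, q i⟩) :
    Tw.Hom.elt (f ≫ innerMap p q i) =
      (TO.operad P).comp (TO.const p)
        (Function.update (fun i => TO.const (q i)) i (Tw.Hom.elt f)) := by
  obtain ⟨t, ht, -, H⟩ := exists_rep f
  rw [ht, H _ _ _ rfl]
  refine Eq.trans (congrArg TO.mk ?_) (TO.comp_update (.const p) (fun i => .const (q i)) i t)
  simp only [Term.bind]
  congr 1
  funext j
  by_cases hj : j = i
  · subst hj; simp [Term.bind]
  · simp [Function.update_of_ne hj, Term.bind]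

theorem inputMap_elt (p : Tw P) (j : Fin p.arity) :
    Tw.Hom.elt (inputMap p j) = (TO.operad P).pre (TO.const p.op)
      (Function.update (fun i => (TO.operad P).one (p.input i)) j
        (TO.var (Tw.one P (p.input j)))) :=
  congrArg (TO.perm _ _) (TO.comp_update _ _ _ _)

theorem outputMap_elt (p : Tw P) :
    Tw.Hom.elt (outputMap p) =
      (TO.operad P).post (TO.var (Tw.one P p.output)) (TO.const p.op) :=
  congrArg (TO.perm _ _) (TO.comp_mk _ _).symm

theorem inputMap_one (c : C) : inputMap (Tw.one P c) 0 = 𝟙 (Tw.one P c) := by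
  refine hom_ext ((inputMap_elt _ _).trans
    (Eq.trans ?_ ((TO.operad P).one_pre (TO.var (Tw.one P c)))))
  refine congrArg ((TO.operad P).pre _) (funext fun i => ?_)
  obtain rfl := Subsingleton.elim i 0
  rw [Function.update_self]

theorem outputMap_one (c : C) : outputMap (Tw.one P c) = 𝟙 (Tw.one P c) :=
  hom_ext ((outputMap_elt _).trans ((TO.operad P).post_one (TO.var (Tw.one P c))))

theorem inputMap_perm {m : ℕ} (e : Fin m ≃ Fin n) (i : Fin m) :
    inputMap ⟨m, fun i => c (e i), d, P.perm e (fun _ => rfl) p⟩ i =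
      inputMap ⟨n, c, d, p⟩ (e i) ≫ permMap e (fun _ => rfl) p := by
  refine hom_ext ?_
  rw [comp_permMap, inputMap_elt, inputMap_elt, ← pre_perm, TO.const_perm]
  refine congrArg ((TO.operad P).pre _) ?_
  exact (Function.update_comp_eq_of_injective' (fun i => (TO.operad P).one (c i)) e.injective i
    (TO.var (Tw.one P (c (e i))))).symm

theorem outputMap_perm {m : ℕ} {a : Fin m → C} (e : Fin m ≃ Fin n) (h : ∀ i, a i = c (e i)) :
    outputMap ⟨m, a, d, P.perm e h p⟩ = outputMap ⟨n, c, d, p⟩ ≫ permMap e h p := by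
  refine hom_ext ?_
  rw [comp_permMap, outputMap_elt, outputMap_elt, ← post_perm, TO.const_perm]

theorem outputMap_comp :
    outputMap ⟨_, concat b, d, P.comp p q⟩ = outputMap ⟨n, c, d, p⟩ ≫ outerMap p q := by
  refine hom_ext ?_
  rw [comp_outerMap, outputMap_elt, outputMap_elt, TO.const_comp]
  exact post_comp _ _ _ _

/-- The colour at which `q i` is grafted onto `p`, seen as an input of `p` and as the output
of `q i`. -/
theorem inputMap_outerMap (i : Fin n) :
    inputMap ⟨n, c, d, p⟩ i ≫ outerMap p q =
      outputMap ⟨k i, b i, c i, q i⟩ ≫ innerMap p q i := by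
  refine hom_ext ?_
  rw [comp_outerMap, inputMap_elt, comp_innerMap, outputMap_elt]
  refine (comp_pre _ _ _ _).trans (congrArg ((TO.operad P).comp _) (funext fun j => ?_))
  by_cases hj : j = i
  · subst hj; rw [Function.update_self, Function.update_self]
  · rw [Function.update_of_ne hj, Function.update_of_ne hj]
    exact one_post _ _

/-- An input of a composite is an input of one of the inner operations. -/
theorem inputMap_comp (l : Fin (∑ i, k i)) :
    inputMap ⟨_, concat b, d, P.comp p q⟩ l =
      inputMap ⟨k (split l).1, b (split l).1, c (split l).1, q (split l).1⟩ (split l).2 ≫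
        innerMap p q (split l).1 := by
  refine hom_ext ?_
  rw [comp_innerMap, inputMap_elt, inputMap_elt, TO.const_comp]
  have h := pre_comp (TO.operad P) (TO.const p) (fun i => TO.const (q i))
    (fun i j => Function.update (fun s : (i : Fin n) × Fin (k i) =>
      (TO.operad P).one (b s.1 s.2)) (split l)
        (TO.var (Tw.one P (b (split l).1 (split l).2))) ⟨i, j⟩)
  refine Eq.trans (congrArg ((TO.operad P).pre _) (funext fun l' => ?_)) (h.trans ?_)
  · exact (congrFun (Function.update_comp_eq_of_injective' (fun s : (i : Fin n) × Fin (k i) =>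
      (TO.operad P).one (b s.1 s.2)) finSigmaFinEquiv.symm.injective l
        (TO.var (Tw.one P (b (split l).1 (split l).2)))) l').symm
  · refine congrArg ((TO.operad P).comp _) (funext fun i => ?_)
    by_cases hi : i = (split l).1
    · subst hi
      rw [Function.update_self]
      refine congrArg ((TO.operad P).pre _) ?_
      exact Function.update_comp_eq_of_injective' (fun s : (i : Fin n) × Fin (k i) =>
        (TO.operad P).one (b s.1 s.2)) (sigma_mk_injective (i := (split l).1)) (split l).2
          (TO.var (Tw.one P (b (split l).1 (split l).2)))
    · rw [Function.update_of_ne hi]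
      refine Eq.trans (congrArg ((TO.operad P).pre _) (funext fun j => ?_)) (pre_one _ _)
      exact Function.update_of_ne (fun h => hi (congrArg Sigma.fst h)) _ _

end

theorem _root_.Multiset.eq_singleton_of_add_eq_singleton {α : Type*} {s t : Multiset α} {a : α}
    (h : s + t = {a}) : s = {a} ∧ t = 0 ∨ s = 0 ∧ t = {a} := by
  have hc := congrArg Multiset.card h
  rw [Multiset.card_add, Multiset.card_singleton] at hc
  obtain hs | ht : Multiset.card s = 0 ∨ Multiset.card t = 0 := by omega
  · obtain rfl := Multiset.card_eq_zero.1 hs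
    exact .inr ⟨rfl, by simpa using h⟩
  · obtain rfl := Multiset.card_eq_zero.1 ht
    exact .inl ⟨by simpa using h, rfl⟩

theorem _root_.Multiset.exists_eq_singleton_of_sum_eq_singleton {ι α : Type*} [Fintype ι]
    [DecidableEq ι] {m : ι → Multiset α} {a : α} (h : ∑ i, m i = {a}) :
    ∃ i, m i = {a} ∧ ∀ j, j ≠ i → m j = 0 := by
  obtain ⟨i, -, hi⟩ := Multiset.mem_sum.1 (h ▸ Multiset.mem_singleton_self a)
  rw [← Finset.add_sum_erase _ _ (Finset.mem_univ i)] at h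
  obtain ⟨h, h'⟩ | ⟨h, -⟩ := Multiset.eq_singleton_of_add_eq_singleton h
  · exact ⟨i, h, fun j hj => Finset.sum_eq_zero_iff.1 h' j (by simpa using hj)⟩
  · simp [h] at hi

/-- Every morphism of the twisted arrow category is a composite of renumberings of inputs and of
inclusions of the outer and of the inner operations into composites. -/
theorem hom_induction (W : MorphismProperty (Tw P)) (hid : ∀ p, W (𝟙 p))
    (hcomp : ∀ {p q r : Tw P} (f : p ⟶ q) (g : q ⟶ r), W f → W g → W (f ≫ g))
    (hperm : ∀ {m n : ℕ} {a : Fin m → C} {c : Fin n → C} {d : C} (e : Fin m ≃ Fin n)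
      (h : ∀ i, a i = c (e i)) (p : P.Op c d), W (permMap e h p))
    (houter : ∀ {n : ℕ} {c : Fin n → C} {d : C} {k : Fin n → ℕ} {b : ∀ i, Fin (k i) → C}
      (p : P.Op c d) (q : ∀ i, P.Op (b i) (c i)), W (outerMap p q))
    (hinner : ∀ {n : ℕ} {c : Fin n → C} {d : C} {k : Fin n → ℕ} {b : ∀ i, Fin (k i) → C}
      (p : P.Op c d) (q : ∀ i, P.Op (b i) (c i)) (i : Fin n), W (innerMap p q i))
    {p r : Tw P} (f : p ⟶ r) : W f := by
  have congr {q : Tw P} {f g : p ⟶ q} (h : Tw.Hom.elt f = Tw.Hom.elt g) (hf : W f) : W g :=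
    hom_ext h ▸ hf
  have key : ∀ {n : ℕ} {c : Fin n → C} {d : C} (t : Term P c d) (r : P.Op c d)
      (hv : t.vars = {p}) (he : t.eval = r),
      W (Tw.Hom.mk (TO.mk t) hv he : p ⟶ ⟨n, c, d, r⟩) := by
    intro n c d t
    induction t with
    | var q =>
      rintro _ hv rfl
      obtain rfl : q = p := Multiset.singleton_inj.1 hv
      exact hid q
    | const q => exact fun _ hv => absurd hv.symm (Multiset.singleton_ne_zero p)
    | @perm m n a c d e h t ih =>
      rintro _ hv rfl
      let f : p ⟶ ⟨n, c, d, t.eval⟩ := Tw.Hom.mk (TO.mk t) hv rfl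
      have hf : Tw.Hom.elt (f ≫ permMap e h t.eval) = TO.mk (.perm e h t) :=
        comp_permMap e h t.eval f
      exact congr hf (hcomp f _ (ih _ hv rfl) (hperm e h t.eval))
    | @comp n c d k b t s ih ih' =>
      rintro _ hv rfl
      obtain ⟨ht, hs⟩ | ⟨ht, hs⟩ := Multiset.eq_singleton_of_add_eq_singleton hv
      -- The variable occurs in `t`, so that the `s i` are constants.
      · let f : p ⟶ ⟨n, c, d, t.eval⟩ := Tw.Hom.mk (TO.mk t) ht rfl
        have hf : Tw.Hom.elt (f ≫ outerMap t.eval fun i => (s i).eval) =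
            TO.mk (.comp t s) := by
          refine (comp_outerMap _ _ f).trans (Eq.trans ?_ (TO.comp_mk t s))
          exact congrArg (TO.comp _) (funext fun i => (TO.mk_eq_const (s i)
            (Finset.sum_eq_zero_iff.1 hs i (Finset.mem_univ i))).symm)
        exact congr hf (hcomp f _ (ih _ ht rfl) (houter _ _))
      -- The variable occurs in `s i`, so that `t` and the other `s j` are constants.
      · obtain ⟨i, hi, hi'⟩ := Multiset.exists_eq_singleton_of_sum_eq_singleton hs
        let f : p ⟶ ⟨k i, b i, c i, (s i).eval⟩ := Tw.Hom.mk (TO.mk (s i)) hi rfl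
        have hf : Tw.Hom.elt (f ≫ innerMap t.eval (fun i => (s i).eval) i) =
            TO.mk (.comp t s) := by
          refine (comp_innerMap _ (fun i => (s i).eval) i f).trans
            (Eq.trans ?_ (TO.comp_mk t s))
          rw [TO.mk_eq_const t ht]
          refine congrArg (TO.comp _) (funext fun j => ?_)
          by_cases hj : j = i
          · subst hj
            exact Function.update_self (β := fun i => TO P (b i) (c i)) _ _ _
          · exact (Function.update_of_ne (β := fun i => TO P (b i) (c i)) hj _ _).trans
              (TO.mk_eq_const (s j) (hi' j hj)).symm
        exact congr hf (hcomp f _ (ih' i _ hi rfl) (hinner _ _ _))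
  obtain ⟨⟨t⟩, hv, he⟩ := f
  exact key t _ hv he

end Tw

/-! ### Arguments of the variables of a formal expression -/

section reindex

variable {A : C → Type w} {m n : ℕ} {a : Fin m → C} {c : Fin n → C}

/-- Reindexing of a family of elements along a bijection that respects the colours. -/
def reindex (e : Fin m ≃ Fin n) (h : ∀ i, a i = c (e i)) (x : ∀ i, A (a i)) : ∀ i, A (c i) :=
  fun i => cast (by rw [h, e.apply_symm_apply]) (x (e.symm i))

theorem reindex_heq (e : Fin m ≃ Fin n) (h : ∀ i, a i = c (e i)) (x : ∀ i, A (a i)) (i : Fin m) :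
    reindex e h x (e i) ≍ x i :=
  (cast_heq _ _).trans (congr_arg_heq x (e.symm_apply_apply i))

theorem reindex_eq_of_heq {e : Fin m ≃ Fin n} {h : ∀ i, a i = c (e i)} {x : ∀ i, A (a i)}
    {y : ∀ i, A (c i)} (H : ∀ i, x i ≍ y (e i)) : reindex e h x = y := by
  funext i
  obtain ⟨i, rfl⟩ := e.surjective i
  exact eq_of_heq ((reindex_heq e h x i).trans (H i))

theorem reindex_apply (e : Fin m ≃ Fin n) (x : ∀ i, A (c i)) :
    reindex (a := fun i => c (e i)) e (fun _ => rfl) (fun i => x (e i)) = x :=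
  reindex_eq_of_heq fun _ => HEq.rfl

theorem exists_comp_perm {β : Fin n → Type w} (e : Fin m ≃ Fin n) (x : ∀ i, β (e i)) :
    ∃ y : ∀ i, β i, x = fun i => y (e i) :=
  ⟨Equiv.piCongrLeft β e x, funext fun i => (Equiv.piCongrLeft_apply_apply β e x i).symm⟩

theorem reindex_map {B : C → Type w} (φ : ∀ c, A c → B c) (e : Fin m ≃ Fin n)
    (h : ∀ i, a i = c (e i)) (x : ∀ i, A (a i)) :
    reindex e h (fun i => φ (a i) (x i)) = fun i => φ (c i) (reindex e h x i) := by
  obtain rfl : a = fun i => c (e i) := funext h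
  obtain ⟨y, rfl⟩ := exists_comp_perm (β := fun i => A (c i)) e x
  rw [reindex_apply, reindex_apply e fun i => φ (c i) (y i)]

theorem reindex_oneBlock (x : ∀ _ : Fin 1, ∀ i, A (c i)) :
    reindex (c := c) (oneBlock n) (concat_oneBlock c) (fun l => x (split l).1 (split l).2) =
      x 0 :=
  reindex_eq_of_heq fun l => by rw [Subsingleton.elim (split l).1 0]; rfl

theorem reindex_unitBlocks (x : ∀ i, ∀ _ : Fin 1, A (c i)) :
    reindex (c := c) (unitBlocks n) (concat_unitBlocks c)
      (fun l => x (split l).1 (split l).2) = fun i => x i 0 :=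
  reindex_eq_of_heq fun l => by rw [Subsingleton.elim (split l).2 0]; rfl

variable {k : Fin n → ℕ} {b : ∀ i, Fin (k i) → C}

theorem reindex_permBlocks (e : Fin m ≃ Fin n) (x : ∀ i j, A (b i j)) :
    reindex (permBlocks e k) (concat_permBlocks b e)
        (fun l => x (e (split l).1) (split l).2) =
      fun l => x (split l).1 (split l).2 :=
  reindex_eq_of_heq fun l => (cat_heq x ⟨e (split l).1, (split l).2⟩).symm

theorem reindex_innerBlocks {k' : Fin n → ℕ} {b' : ∀ i, Fin (k' i) → C}
    (e : ∀ i, Fin (k' i) ≃ Fin (k i)) (h : ∀ i j, b' i j = b i (e i j))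
    (x : ∀ i j, A (b' i j)) :
    reindex (innerBlocks e) (concat_innerBlocks b e h) (fun l => x (split l).1 (split l).2) =
      fun l => reindex (e (split l).1) (h (split l).1) (x (split l).1) (split l).2 :=
  reindex_eq_of_heq fun l => (reindex_heq _ _ _ _).symm.trans
    (cat_heq (fun i => reindex (e i) (h i) (x i))
      ⟨(split l).1, e (split l).1 (split l).2⟩).symm

theorem reindex_assocBlocks {m : ∀ i, Fin (k i) → ℕ} {a : ∀ i j, Fin (m i j) → C}
    (x : ∀ i j h, A (a i j h)) :
    reindex (assocBlocks m) (concat_assocBlocks a)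
        (fun l => x (split (split l).1).1 (split (split l).1).2 (split l).2) =
      fun l : Fin (∑ i, ∑ j, m i j) => x (split (k := fun i => ∑ j, m i j) l).1
        (split (split (k := fun i => ∑ j, m i j) l).2).1
        (split (split (k := fun i => ∑ j, m i j) l).2).2 :=
  reindex_eq_of_heq fun l => ((cat_heq
      (fun i (l' : Fin (∑ j, m i j)) => x i (split l').1 (split l').2)
      ⟨(split (split l).1).1, finSigmaFinEquiv ⟨(split (split l).1).2, (split l).2⟩⟩).trans
    (cat_heq (x _) ⟨(split (split l).1).2, (split l).2⟩)).symm

end reindex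

theorem Algebra.act_perm' (A : Algebra.{u, v, w} P) {m n : ℕ} {a : Fin m → C} {c : Fin n → C}
    {d : C} (e : Fin m ≃ Fin n) (h : ∀ i, a i = c (e i)) (p : P.Op c d)
    (x : ∀ i, A.carrier (a i)) :
    A.act (P.perm e h p) x = A.act p (reindex e h x) := by
  obtain rfl : a = fun i => c (e i) := funext h
  rw [← A.act_perm e]
  congr 1
  exact funext fun i => eq_of_heq (reindex_heq e h x i).symm

theorem Algebra.act_comp' (A : Algebra.{u, v, w} P) {n : ℕ} {c : Fin n → C} {d : C}
    {k : Fin n → ℕ} {b : ∀ i, Fin (k i) → C} (p : P.Op c d) (q : ∀ i, P.Op (b i) (c i))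
    (x : ∀ l, A.carrier (concat b l)) :
    A.act (P.comp p q) x =
      A.act p fun i => A.act (q i) (block (β := fun i j => A.carrier (b i j)) x i) := by
  obtain ⟨y, rfl⟩ := exists_cat (β := fun i j => A.carrier (b i j)) x
  rw [block_cat]
  exact A.act_comp p q y

/-- Evaluate a formal expression in an algebra, from the inputs `x` on, and record the families
of elements to which the variables are applied. -/
def Term.args (A : Algebra.{u, v, w} P) {n : ℕ} {c : Fin n → C} {d : C} :
    Term P c d → (∀ i, A.carrier (c i)) →
      Multiset ((p : Tw P) × (∀ i, A.carrier (p.input i)))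
  | var p, x => {⟨p, x⟩}
  | const _, _ => 0
  | perm e h t, x => t.args A (reindex e h x)
  | @comp _ _ _ _ _ _ b t s, x =>
    t.args A (fun i => A.act (s i).eval (block (β := fun i j => A.carrier (b i j)) x i)) +
      ∑ i, (s i).args A (block (β := fun i j => A.carrier (b i j)) x i)

section args

variable (A : Algebra.{u, v, w} P)

theorem Term.args_comp_cat {n : ℕ} {c : Fin n → C} {d : C} {k : Fin n → ℕ}
    {b : ∀ i, Fin (k i) → C} (t : Term P c d) (s : ∀ i, Term P (b i) (c i))
    (x : ∀ i j, A.carrier (b i j)) :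
    (comp t s).args A (fun l => x (split l).1 (split l).2) =
      t.args A (fun i => A.act (s i).eval (x i)) + ∑ i, (s i).args A (x i) := by
  rw [args, block_cat]

/-- The recorded arguments are well defined on `TO(P)`: relations between expressions neither
change the values of their subexpressions nor the applications of the variables. -/
theorem Term.Rel.args_eq {n : ℕ} {c : Fin n → C} {d : C} {t t' : Term P c d} (h : Rel t t') :
    t.args A = t'.args A := by
  induction h with
  | refl => rfl
  | symm _ ih => exact ih.symm
  | trans _ _ ih ih' => exact ih.trans ih'
  | congr_perm e h _ ih => simp only [Term.args, ih]
  | congr_comp _ h ih ih' =>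
    funext x
    simp only [Term.args, ih, ih', (h _).eval_eq]
  | perm_refl t =>
    funext x
    exact congrArg (t.args A) (reindex_eq_of_heq fun _ => HEq.rfl)
  | perm_perm e f h h' t =>
    funext x
    refine congrArg (t.args A) (reindex_eq_of_heq fun i => ?_).symm
    exact ((reindex_heq f h' _ _).trans (reindex_heq e h x i)).symm
  | @one_comp n c d t =>
    funext x
    obtain ⟨x, rfl⟩ := exists_cat (k := fun _ : Fin 1 => n) (β := fun i j => A.carrier (c j)) x
    rw [Term.args_comp_cat A (Term.const (P.one d)) (fun _ => t)]
    rw [Fin.sum_univ_one]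
    exact (zero_add _).trans (congrArg (t.args A) (reindex_oneBlock x).symm)
  | @comp_one n c d t =>
    funext x
    obtain ⟨x, rfl⟩ := exists_cat (k := fun _ : Fin n => 1) (β := fun i _ => A.carrier (c i)) x
    rw [Term.args_comp_cat A t fun i => Term.const (P.one (c i))]
    simp only [Term.args, Finset.sum_const_zero, add_zero, Term.eval, A.act_one]
    exact congrArg (t.args A) (reindex_unitBlocks x).symm
  | @assoc n c d k b m a t s r =>
    funext x
    obtain ⟨x, rfl⟩ := exists_cat (k := fun l => m (split l).1 (split l).2)
      (β := fun l j => A.carrier (a (split l).1 (split l).2 j)) x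
    obtain ⟨x, rfl⟩ := exists_cat
      (β := fun i j => ∀ h, A.carrier (a i j h)) x
    refine Eq.trans ?_ (congrArg (Term.args A (t.comp fun i => (s i).comp (r i)))
      (reindex_assocBlocks x).symm)
    refine (Term.args_comp_cat A (t.comp s) (fun l => r (split l).1 (split l).2)
      fun l => x (split l).1 (split l).2).trans ?_
    rw [Term.args_comp_cat A t (fun i => (s i).comp (r i))
        fun i l => x i (split l).1 (split l).2]
    have h : ∀ i, ((s i).comp (r i)).args A (fun l => x i (split l).1 (split l).2) = _ :=
      fun i => Term.args_comp_cat A (s i) (r i) (x i)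
    have h' : ∀ i, A.act ((s i).comp (r i)).eval (fun l => x i (split l).1 (split l).2) = _ :=
      fun i => A.act_comp (s i).eval (fun j => (r i j).eval) (x i)
    simp only [h, h', Finset.sum_add_distrib]
    rw [Term.args_comp_cat A t s fun i j => A.act (r i j).eval (x i j), add_assoc]
    congr 2
    rw [← Fintype.sum_sigma' (fun i j => (r i j).args A (x i j))]
    exact Fintype.sum_equiv finSigmaFinEquiv.symm _ _ fun _ => rfl
  | @perm_comp m n c d k b e t s =>
    funext x
    obtain ⟨x, rfl⟩ := exists_cat (k := fun i => k (e i))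
      (β := fun i j => A.carrier (b (e i) j)) x
    obtain ⟨x, rfl⟩ := exists_comp_perm (β := fun i => ∀ j, A.carrier (b i j)) e x
    refine Eq.trans ?_ (congrArg (Term.args A (t.comp s)) (reindex_permBlocks e x).symm)
    rw [Term.args_comp_cat A t s,
      Term.args_comp_cat A (t.perm e fun _ => rfl) (fun i => s (e i)) fun i => x (e i)]
    congr 1
    · exact congrArg (t.args A) (reindex_apply e fun i => A.act (s i).eval (x i))
    · exact Fintype.sum_equiv e _ _ fun _ => rfl
  | @comp_perm n c d k k' b b' t s e h =>
    funext x
    obtain ⟨x, rfl⟩ := exists_cat (β := fun i j => A.carrier (b' i j)) x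
    refine Eq.trans ?_ (congrArg (Term.args A (t.comp s)) (reindex_innerBlocks e h x).symm)
    rw [Term.args_comp_cat A t s fun i => reindex (e i) (h i) (x i),
      Term.args_comp_cat A t fun i => (s i).perm (e i) (h i)]
    congr 2
    exact funext fun i => A.act_perm' (e i) (h i) (s i).eval (x i)
  | const_perm => rfl
  | const_comp => funext x; simp [Term.args]

theorem Term.map_fst_args {n : ℕ} {c : Fin n → C} {d : C} (t : Term P c d)
    (x : ∀ i, A.carrier (c i)) : (t.args A x).map Sigma.fst = t.vars := by
  induction t with
  | var p => rfl
  | const p => rfl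
  | perm e h t ih => exact ih _
  | comp t s ih ih' =>
    simp only [args, vars, Multiset.map_add, ih]
    congr 1
    rw [← Multiset.coe_mapAddMonoidHom, map_sum]
    exact Finset.sum_congr rfl fun i _ => ih' i _

/-- Substitution of expressions for the variables: since the substituted expressions have the
values prescribed by the variables, their arguments are recorded inside those of the variables. -/
theorem Term.args_bind {f : ∀ p : Tw P, Term P p.input p.output} (hf : ∀ p, (f p).eval = p.op)
    {n : ℕ} {c : Fin n → C} {d : C} (t : Term P c d) (x : ∀ i, A.carrier (c i)) :
    (t.bind f).args A x = (t.args A x).bind fun z => (f z.1).args A z.2 := by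
  induction t with
  | var p => simp [args, bind]
  | const p => rfl
  | perm e h t ih => exact ih _
  | comp t s ih ih' =>
    simp only [args, bind, Multiset.add_bind, ih, ih', eval_bind hf]
    congr 1
    exact (map_sum (⟨⟨fun m => m.bind fun z => (f z.1).args A z.2, rfl⟩,
      fun a b => Multiset.add_bind a b _⟩ :
        Multiset ((p : Tw P) × (∀ i, A.carrier (p.input i))) →+ _) _ _).symm

variable {A} in
theorem Term.args_map {B : Algebra.{u, v, w} P} (φ : A ⟶ B) {n : ℕ} {c : Fin n → C} {d : C}
    (t : Term P c d) (x : ∀ i, A.carrier (c i)) :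
    t.args B (fun i => Algebra.Hom.map φ (c i) (x i)) =
      (t.args A x).map fun z => ⟨z.1, fun i => Algebra.Hom.map φ _ (z.2 i)⟩ := by
  induction t with
  | var p => rfl
  | const p => rfl
  | perm e h t ih =>
    exact (congrArg (t.args B) (reindex_map (fun c => Algebra.Hom.map φ c) e h x)).trans (ih _)
  | @comp n c d k b t s ih ih' =>
    obtain ⟨x, rfl⟩ := exists_cat (β := fun i j => A.carrier (b i j)) x
    refine (args_comp_cat B t s fun i j => Algebra.Hom.map φ _ (x i j)).trans ?_
    rw [args_comp_cat A t s, Multiset.map_add, ← ih]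
    congr 1
    · exact congrArg (t.args B) (funext fun i => (Algebra.Hom.map_act φ _ _).symm)
    · rw [← Multiset.coe_mapAddMonoidHom, map_sum]
      exact Finset.sum_congr rfl fun i _ => ih' i _

/-- The arguments of the variables of an element of `TO(P)` at given inputs. -/
def TO.args {n : ℕ} {c : Fin n → C} {d : C} (y : TO P c d) :
    (∀ i, A.carrier (c i)) → Multiset ((p : Tw P) × (∀ i, A.carrier (p.input i))) :=
  Quotient.lift (Term.args A) (fun _ _ h => Term.Rel.args_eq A h) y

/-! ### The presheaf of an algebra -/

section restrict

variable {p q r : Tw P}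

theorem exists_args_eq (f : p ⟶ q) (x : ∀ i, A.carrier (q.input i)) :
    ∃ y, (Tw.Hom.elt f).args A x = {⟨p, y⟩} := by
  obtain ⟨⟨t⟩, ht, -⟩ := f
  obtain ⟨⟨_, y⟩, h, rfl⟩ := Multiset.map_eq_singleton.1 ((t.map_fst_args A x).trans ht)
  exact ⟨y, h⟩

/-- The family of elements to which a morphism `p ⟶ q` applies its variable `p`, if a family of
elements is inserted into its inputs. -/
noncomputable def restrict (f : p ⟶ q) (x : ∀ i, A.carrier (q.input i)) :
    ∀ i, A.carrier (p.input i) :=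
  (exists_args_eq A f x).choose

theorem args_elt (f : p ⟶ q) (x : ∀ i, A.carrier (q.input i)) :
    (Tw.Hom.elt f).args A x = {⟨p, restrict A f x⟩} :=
  (exists_args_eq A f x).choose_spec

variable {A}

theorem restrict_eq {f : p ⟶ q} {x : ∀ i, A.carrier (q.input i)}
    {y : ∀ i, A.carrier (p.input i)} (h : (Tw.Hom.elt f).args A x = {⟨p, y⟩}) :
    restrict A f x = y :=
  eq_of_heq (Sigma.mk.inj (Multiset.singleton_inj.1 ((args_elt A f x).symm.trans h))).2

variable (A)

theorem restrict_id (x : ∀ i, A.carrier (p.input i)) : restrict A (𝟙 p) x = x :=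
  restrict_eq rfl

theorem restrict_comp (f : p ⟶ q) (g : q ⟶ r) (x : ∀ i, A.carrier (r.input i)) :
    restrict A (f ≫ g) x = restrict A f (restrict A g x) := by
  classical
  refine restrict_eq ?_
  obtain ⟨t, ht, he, H⟩ := Tw.exists_rep f
  obtain ⟨s, hs⟩ := TO.mk_surjective (Tw.Hom.elt g)
  have hg := args_elt A g x
  have hf := args_elt A f (restrict A g x)
  rw [hs] at hg
  rw [ht] at hf
  rw [H _ g s hs]
  refine (Term.args_bind A (fun p => ?_) s x).trans ?_
  · by_cases hp : p = q
    · subst hp; rw [Function.update_self]; exact he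
    · rw [Function.update_of_ne hp]; rfl
  · change s.args A x = _ at hg
    rw [hg, Multiset.singleton_bind, Function.update_self]
    exact hf

theorem restrict_map {A B : Algebra.{u, v, w} P} (φ : A ⟶ B) (f : p ⟶ q)
    (x : ∀ i, A.carrier (q.input i)) :
    restrict B f (fun i => Algebra.Hom.map φ _ (x i)) =
      fun i => Algebra.Hom.map φ _ (restrict A f x i) := by
  refine restrict_eq ?_
  obtain ⟨t, ht⟩ := TO.mk_surjective (Tw.Hom.elt f)
  have hf := args_elt A f x
  rw [ht] at hf ⊢
  change t.args A x = _ at hf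
  refine (t.args_map φ x).trans ?_
  rw [hf, Multiset.map_singleton]

end restrict

section generators

variable {n : ℕ} {c : Fin n → C} {d : C} {k : Fin n → ℕ} {b : ∀ i, Fin (k i) → C}
  (p : P.Op c d) (q : ∀ i, P.Op (b i) (c i))

theorem restrict_permMap {m : ℕ} (e : Fin m ≃ Fin n) (x : ∀ i, A.carrier (c i)) :
    restrict A (Tw.permMap (a := fun i => c (e i)) e (fun _ => rfl) p) (fun i => x (e i)) = x :=
  restrict_eq (congrArg (Term.args A (.var ⟨n, c, d, p⟩)) (reindex_apply e x))

/-- The outer operation of a composite is applied to the values of the inner operations. -/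
theorem restrict_outerMap (x : ∀ i j, A.carrier (b i j)) :
    restrict A (Tw.outerMap p q) (fun l => x (split l).1 (split l).2) =
      fun i => A.act (q i) (x i) := by
  refine restrict_eq ((Term.args_comp_cat A (.var ⟨n, c, d, p⟩)
    (fun i => .const (q i)) x).trans ?_)
  simp [Term.args, Term.eval]

theorem restrict_innerMap (i : Fin n) (x : ∀ i j, A.carrier (b i j)) :
    restrict A (Tw.innerMap p q i) (fun l => x (split l).1 (split l).2) = x i := by
  refine restrict_eq ((Term.args_comp_cat A (.const p)
    (Function.update (fun i => .const (q i)) i (.var ⟨k i, b i, c i, q i⟩)) x).trans ?_)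
  rw [Term.args, zero_add, Finset.sum_eq_single i]
  · rw [Function.update_self]; rfl
  · intro j _ hj; rw [Function.update_of_ne hj]; rfl
  · simp

theorem restrict_inputMap (p : Tw P) (i : Fin p.arity) (x : ∀ i, A.carrier (p.input i)) :
    restrict A (Tw.inputMap p i) x = fun _ => x i := by
  refine restrict_eq ?_
  change Term.args A (.comp _ _) _ = _
  have hx : reindex (unitBlocks p.arity).symm (concat_unitBlocks_symm p.input) x =
      fun l => (fun i (_ : Fin 1) => x i) (split l).1 (split l).2 :=
    reindex_eq_of_heq fun i => (cat_heq (fun i (_ : Fin 1) => x i) ⟨i, 0⟩).symm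
  rw [hx, Term.args_comp_cat A (k := fun _ => 1) (b := fun i _ => p.input i) (.const p.op)
    (Function.update (fun i => .const (P.one (p.input i))) i (.var (Tw.one P (p.input i))))
    fun i _ => x i]
  rw [Term.args, zero_add, Finset.sum_eq_single i]
  · rw [Function.update_self]; rfl
  · intro j _ hj; rw [Function.update_of_ne hj]; rfl
  · simp

theorem restrict_outputMap (p : Tw P) (x : ∀ i, A.carrier (p.input i)) :
    restrict A (Tw.outputMap p) x = fun _ => A.act p.op x := by
  refine restrict_eq ?_
  change Term.args A (.comp _ _) _ = _
  have hx : reindex (oneBlock p.arity).symm (oneBlock_symm_colour p.input) x =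
      fun l => x (split (k := fun _ : Fin 1 => p.arity) l).2 :=
    reindex_eq_of_heq fun i => by
      obtain ⟨l, rfl⟩ := (oneBlock p.arity).surjective i
      rw [Equiv.symm_apply_apply]
      rfl
  rw [hx]
  refine (Term.args_comp_cat A (k := fun _ => p.arity) (.var (Tw.one P p.output))
    (fun _ => .const p.op) fun _ i => x i).trans ?_
  simp [Term.args, Term.eval]

end generators

end args

/-- The presheaf of an algebra: its value at an operation is the set of families of elements
to which the operation can be applied. -/
noncomputable def presheaf (A : Algebra.{u, v, w} P) : (Tw P)ᵒᵖ ⥤ Type w where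
  obj p := ∀ i, A.carrier (p.unop.input i)
  map f := ↾(restrict A f.unop)
  map_id p := by ext x; exact congrFun (restrict_id A x) _
  map_comp f g := by ext x; exact congrFun (restrict_comp A g.unop f.unop x) _

theorem isSingleObjectSegal_presheaf (A : Algebra.{u, v, w} P) :
    IsSingleObjectSegal.{u, v, w} P (presheaf A) := by
  intro p
  have h : (fun (x : (presheaf A).obj (op p)) (j : Fin p.arity) =>
      (presheaf A).map (Tw.inputMap p j).op x) = fun x j _ => x j :=
    funext fun x => funext fun j => restrict_inputMap A p j x
  rw [h]
  exact ⟨fun x y hxy => funext fun j => congrFun (congrFun hxy j) 0, fun y =>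
    ⟨fun j => y j 0, funext fun j => funext fun i => by
      rw [Subsingleton.elim i 0]⟩⟩

variable (P) in
/-- The functor from algebras to presheaves. -/
noncomputable def presheafFunctor : Algebra.{u, v, w} P ⥤ (Tw P)ᵒᵖ ⥤ Type w where
  obj := presheaf
  map {A B} φ :=
    { app p := ↾fun x i => Algebra.Hom.map φ (p.unop.input i) (x i)
      naturality p q f := by
        ext x
        exact (restrict_map φ f.unop x).symm }

instance : (presheafFunctor.{u, v, w} P).Faithful where
  map_injective {A B} φ ψ h := by
    refine Algebra.Hom.ext (funext fun c => funext fun x => ?_)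
    have := congrArg (fun τ : presheaf A ⟶ presheaf B =>
      (show ∀ _ : Fin 1, B.carrier c from τ.app (op (Tw.one P c)) fun _ => x) 0) h
    exact this

/-- A morphism between presheaves of algebras is determined by its components at the identities,
because the presheaves satisfy the Segal condition. -/
theorem natTrans_apply {A B : Algebra.{u, v, w} P} (τ : presheaf A ⟶ presheaf B) (p : Tw P)
    (x : ∀ i, A.carrier (p.input i)) (i : Fin p.arity) :
    (show ∀ i, B.carrier (p.input i) from τ.app (op p) x) i =
      (show ∀ _ : Fin 1, B.carrier (p.input i) from
        τ.app (op (Tw.one P (p.input i))) fun _ => x i) 0 := by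
  have h := NatTrans.naturality_apply τ (Tw.inputMap p i).op x
  have h₁ : (presheaf A).map (Tw.inputMap p i).op x = fun _ => x i := restrict_inputMap A p i x
  have h₂ : (presheaf B).map (Tw.inputMap p i).op (τ.app (op p) x) = _ :=
    restrict_inputMap B p i _
  rw [h₁, h₂] at h
  exact (congrFun h 0).symm

instance : (presheafFunctor.{u, v, w} P).Full where
  map_surjective {A B} τ := by
    change presheaf A ⟶ presheaf B at τ
    refine ⟨⟨fun c x => (show ∀ _ : Fin 1, B.carrier c from
      τ.app (op (Tw.one P c)) fun _ => x) 0, fun {n c d} p x => ?_⟩, ?_⟩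
    · have h := NatTrans.naturality_apply τ (Tw.outputMap ⟨n, c, d, p⟩).op x
      have h₁ : (presheaf A).map (Tw.outputMap ⟨n, c, d, p⟩).op x = fun _ => A.act p x :=
        restrict_outputMap A ⟨n, c, d, p⟩ x
      have h₂ : (presheaf B).map (Tw.outputMap ⟨n, c, d, p⟩).op
          (τ.app (op ⟨n, c, d, p⟩) x) = _ :=
        restrict_outputMap B ⟨n, c, d, p⟩ _
      rw [h₁, h₂] at h
      refine (congrFun h 0).trans (congrArg (B.act p) (funext fun i => ?_))
      exact natTrans_apply τ ⟨n, c, d, p⟩ x i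
    · ext p x
      exact funext fun i => (natTrans_apply τ p.unop x i).symm

/-! ### The algebra of a Segal presheaf -/

section segal

variable {X : (Tw P)ᵒᵖ ⥤ Type w} (hX : IsSingleObjectSegal.{u, v, w} P X)

/-- The elements of a Segal presheaf at an operation, as families of elements at the identities of
its input colours. -/
noncomputable def segalEquiv (p : Tw P) :
    X.obj (op p) ≃ ∀ j : Fin p.arity, X.obj (op (Tw.one P (p.input j))) :=
  Equiv.ofBijective _ (hX p)

theorem segalEquiv_apply (p : Tw P) (x : X.obj (op p)) (j : Fin p.arity) :
    segalEquiv hX p x j = X.map (Tw.inputMap p j).op x :=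
  rfl

/-- The action of an operation: along its output map, from the element with given
restrictions along its input maps. -/
noncomputable def segalAct (p : Tw P) (x : ∀ j, X.obj (op (Tw.one P (p.input j)))) :
    X.obj (op (Tw.one P p.output)) :=
  X.map (Tw.outputMap p).op ((segalEquiv hX p).symm x)

theorem segalAct_segalEquiv (p : Tw P) (x : X.obj (op p)) :
    segalAct hX p (segalEquiv hX p x) = X.map (Tw.outputMap p).op x := by
  rw [segalAct, Equiv.symm_apply_apply]

theorem segalEquiv_one (c : C) (x : X.obj (op (Tw.one P c))) :
    segalEquiv hX (Tw.one P c) x 0 = x := by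
  rw [segalEquiv_apply, Tw.inputMap_one, op_id, X.map_id]
  rfl

variable {n : ℕ} {c : Fin n → C} {d : C} {k : Fin n → ℕ} {b : ∀ i, Fin (k i) → C}
  (p : P.Op c d) (q : ∀ i, P.Op (b i) (c i))

theorem segalEquiv_permMap {m : ℕ} (e : Fin m ≃ Fin n)
    (x : X.obj (op ⟨m, fun i => c (e i), d, P.perm e (fun _ => rfl) p⟩)) (i : Fin m) :
    segalEquiv hX ⟨n, c, d, p⟩ (X.map (Tw.permMap e (fun _ => rfl) p).op x) (e i) =
      segalEquiv hX ⟨m, fun i => c (e i), d, P.perm e (fun _ => rfl) p⟩ x i := by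
  rw [segalEquiv_apply, segalEquiv_apply, Tw.inputMap_perm, op_comp, X.map_comp_apply]

theorem segalEquiv_innerMap (x : X.obj (op ⟨_, concat b, d, P.comp p q⟩))
    (l : Fin (∑ i, k i)) :
    segalEquiv hX ⟨_, concat b, d, P.comp p q⟩ x l =
      segalEquiv hX ⟨k (split l).1, b (split l).1, c (split l).1, q (split l).1⟩
        (X.map (Tw.innerMap p q (split l).1).op x) (split l).2 := by
  rw [segalEquiv_apply, segalEquiv_apply, Tw.inputMap_comp, op_comp, X.map_comp_apply]

/-- The Segal bijection at the outer operation of a composite is given by the action of the inner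
operations; this is the naturality of the presheaf on the two ways of including the identity of the
`i`-th input colour of `p` into the composite. -/
theorem segalEquiv_outerMap (x : X.obj (op ⟨_, concat b, d, P.comp p q⟩)) (i : Fin n) :
    segalEquiv hX ⟨n, c, d, p⟩ (X.map (Tw.outerMap p q).op x) i =
      segalAct hX ⟨k i, b i, c i, q i⟩ (segalEquiv hX ⟨k i, b i, c i, q i⟩
        (X.map (Tw.innerMap p q i).op x)) := by
  rw [segalEquiv_apply, segalAct_segalEquiv, ← X.map_comp_apply, ← X.map_comp_apply, ← op_comp,
    ← op_comp, Tw.inputMap_outerMap]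

/-- The algebra of a Segal presheaf. -/
noncomputable def segalAlgebra : Algebra.{u, v, w} P where
  carrier c := X.obj (op (Tw.one P c))
  act {n c d} p x := segalAct hX ⟨n, c, d, p⟩ x
  act_one c x := by
    obtain ⟨x, rfl⟩ := (segalEquiv hX (Tw.one P c)).surjective x
    refine (segalAct_segalEquiv hX (Tw.one P c) x).trans ?_
    rw [Tw.outputMap_one, op_id, X.map_id]
    exact (segalEquiv_one hX c x).symm
  act_perm {m n c d} e p x := by
    obtain ⟨y, hy⟩ := (segalEquiv hX
      ⟨m, fun i => c (e i), d, P.perm e (fun _ => rfl) p⟩).surjective fun i => x (e i)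
    have h : segalEquiv hX ⟨n, c, d, p⟩ (X.map (Tw.permMap e (fun _ => rfl) p).op y) = x := by
      funext i
      obtain ⟨i, rfl⟩ := e.surjective i
      exact (segalEquiv_permMap hX p e y i).trans (congrFun hy i)
    rw [← hy, ← h, segalAct_segalEquiv, segalAct_segalEquiv, Tw.outputMap_perm, op_comp,
      X.map_comp_apply]
  act_comp {n c d k b} p q x := by
    obtain ⟨y, hy⟩ := (segalEquiv hX ⟨_, concat b, d, P.comp p q⟩).surjective
      fun l => x (split l).1 (split l).2
    have h : ∀ i, segalEquiv hX ⟨k i, b i, c i, q i⟩ (X.map (Tw.innerMap p q i).op y) = x i := by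
      -- Every pair (block, position) is `split l` for some `l`, for which the claim holds by
      -- definition of `y`.
      have hs : ∀ s : (i : Fin n) × Fin (k i), segalEquiv hX ⟨k s.1, b s.1, c s.1, q s.1⟩
          (X.map (Tw.innerMap p q s.1).op y) s.2 = x s.1 s.2 := by
        intro s
        obtain ⟨l, rfl⟩ := finSigmaFinEquiv.symm.surjective s
        exact (segalEquiv_innerMap hX p q y l).symm.trans (congrFun hy l)
      exact fun i => funext fun j => hs ⟨i, j⟩
    have h' : segalEquiv hX ⟨n, c, d, p⟩ (X.map (Tw.outerMap p q).op y) =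
        fun i => segalAct hX ⟨k i, b i, c i, q i⟩ (x i) :=
      funext fun i => (segalEquiv_outerMap hX p q y i).trans (by rw [h])
    rw [← hy, ← h', segalAct_segalEquiv, segalAct_segalEquiv, Tw.outputMap_comp, op_comp,
      X.map_comp_apply]

/-- The Segal bijections are natural with respect to the presheaf of the associated algebra. It is
enough to check this on the generating morphisms. -/
theorem segalEquiv_naturality {p r : Tw P} (f : p ⟶ r) (x : X.obj (op r)) :
    segalEquiv hX p (X.map f.op x) = restrict (segalAlgebra hX) f (segalEquiv hX r x) := by
  refine Tw.hom_induction (fun p r f => ∀ x : X.obj (op r), segalEquiv hX p (X.map f.op x) =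
    restrict (segalAlgebra hX) f (segalEquiv hX r x)) ?_ ?_ ?_ ?_ ?_ f x
  · intro p x
    rw [op_id, X.map_id]
    exact (restrict_id (segalAlgebra hX) _).symm
  · intro p q r f g hf hg x
    rw [op_comp, X.map_comp_apply, hf, hg]
    exact (restrict_comp (segalAlgebra hX) f g _).symm
  · intro m n a c d e h p x
    obtain rfl : a = fun i => c (e i) := funext h
    refine Eq.trans ?_ (congrArg (restrict (segalAlgebra hX) _)
      (funext (segalEquiv_permMap hX p e x)))
    exact (restrict_permMap (segalAlgebra hX) p e _).symm
  · intro n c d k b p q x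
    refine Eq.trans ?_ (congrArg (restrict (segalAlgebra hX) _)
      (funext (segalEquiv_innerMap hX p q x)).symm)
    refine (funext (segalEquiv_outerMap hX p q x)).trans ?_
    exact (restrict_outerMap (segalAlgebra hX) p q fun i => segalEquiv hX ⟨k i, b i, c i, q i⟩
        (X.map (Tw.innerMap p q i).op x)).symm
  · intro n c d k b p q i x
    refine Eq.trans ?_ (congrArg (restrict (segalAlgebra hX) _)
      (funext (segalEquiv_innerMap hX p q x)).symm)
    exact (restrict_innerMap (segalAlgebra hX) p q i fun i => segalEquiv hX ⟨k i, b i, c i, q i⟩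
        (X.map (Tw.innerMap p q i).op x)).symm

/-- A Segal presheaf is the presheaf of its algebra. -/
noncomputable def presheafSegalAlgebraIso : presheaf (segalAlgebra hX) ≅ X :=
  (NatIso.ofComponents (fun p => (segalEquiv hX p.unop).toIso) fun f => by
    ext x
    exact segalEquiv_naturality hX f.unop x).symm

end segal

end SetOperad

open SetOperad in
theorem mainTheorem2 {C : Type u} (P : SetOperad.{u, v} C) :
    Nonempty ((SetOperad.IsSingleObjectSegal.{u, v, w} P).FullSubcategory ≌
      SetOperad.Algebra.{u, v, w} P) := by
  let F := (IsSingleObjectSegal.{u, v, w} P).lift (presheafFunctor P) isSingleObjectSegal_presheaf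
  have : F.EssSurj := ⟨fun X => ⟨segalAlgebra X.property,
    ⟨ObjectProperty.isoMk _ (presheafSegalAlgebraIso X.property)⟩⟩⟩
  have : F.Faithful := Functor.Faithful.of_comp_iso
    (ObjectProperty.liftCompιIso _ (presheafFunctor P) _)
  have : F.Full := Functor.Full.of_comp_faithful_iso
    (ObjectProperty.liftCompιIso _ (presheafFunctor P) _)
  have : F.IsEquivalence := {}
  exact ⟨F.asEquivalence.symm⟩
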